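/- Corollary (Gelfand–Kirillov conjecture for $D(q)$). Let $q(t)\in\mathbb{C}[t]$ be a polynomial of degree $n\ge 4$. Put $\rho=2q(-\tfrac12)$ and $$p(t)=\frac{-4q(t)q(-t-1)+\rho^2}{(1+2t)^2},$$ which is a polynomial, and let $p_0,p_1\in\mathbb{C}[t]$ be determined by $p(t)=p_0(t^2)+p_1(t^2)\,t$. Let $D(q)$ (the noncommutative Kleinian singularity of type $D$) be the unital associative $\mathbb{C}$-algebra with generators $u,v,w$ and defining relations $$[u,v]=2w+v,\qquad [u,w]=2vu+w+\rho,\qquad [v,w]=-v^2-p_1(u),\qquad w^2=v^2u+vw+\rho v+p_0(u),$$ where $[a,b]=ab-ba$. Let $A_1(\mathbb{C})=\mathbb{C}\langle x,\partial\rangle/(\partial x-x\partial-1)$ be the first Weyl algebra. Then $D(q)$ and $A_1(\mathbb{C})$ are (left and right) Ore domains, so that their skew fields of fractions $\operatorname{Frac} D(q)$ and $\operatorname{Frac} A_1(\mathbb{C})$ exist, and $$\operatorname{Frac} D(q)\;\cong\;\operatorname{Frac} A_1(\mathbb{C})$$ as $\mathbb{C}$-algebras. -/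

import Mathlib

open Polynomial
open scoped nonZeroDivisors

/-! ### Ore domains and their skew fields of fractions -/

/-- A (two-sided) Ore domain: a nontrivial ring without zero divisors in which any two nonzero
elements have a nonzero common left multiple and a nonzero common right multiple. -/
class IsOreDomain (R : Type*) [Ring R] : Prop extends IsDomain R where
  left_ore : ∀ r s : R, s ≠ 0 → ∃ r' s' : R, s' ≠ 0 ∧ s' * r = r' * s
  right_ore : ∀ r s : R, s ≠ 0 → ∃ r' s' : R, s' ≠ 0 ∧ r * s' = s * r'

noncomputable instance IsOreDomain.instOreSet (R : Type*) [Ring R] [IsOreDomain R] :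
    OreLocalization.OreSet R⁰ :=
  (OreLocalization.nonempty_oreSet_iff_of_noZeroDivisors.mpr fun r s => by
    obtain ⟨r', s', hs', h⟩ :=
      IsOreDomain.left_ore r (s : R) (nonZeroDivisors.ne_zero s.2)
    exact ⟨r', ⟨s', mem_nonZeroDivisors_of_ne_zero hs'⟩, h⟩).some

/-- The skew field of fractions `Frac R` of an Ore domain: the Ore localization of `R` at the set
of its nonzero elements. Mathlib provides its structure of a division ring, and that of an algebra
over any commutative ring over which `R` is an algebra. -/
abbrev SkewFrac (R : Type*) [Ring R] [IsOreDomain R] : Type _ :=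
  OreLocalization R⁰ R

/-! ### The first Weyl algebra -/

/-- The two generators of the first Weyl algebra. -/
inductive WeylGen : Type
  | x
  | d

/-- The defining relation `d x - x d = 1` of the first Weyl algebra. -/
inductive WeylRel : FreeAlgebra ℂ WeylGen → FreeAlgebra ℂ WeylGen → Prop
  | comm : WeylRel
      (FreeAlgebra.ι ℂ WeylGen.d * FreeAlgebra.ι ℂ WeylGen.x
        - FreeAlgebra.ι ℂ WeylGen.x * FreeAlgebra.ι ℂ WeylGen.d) 1

/-- The first Weyl algebra `A₁(ℂ) = ℂ⟨x, d⟩ / (d x - x d - 1)`. -/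
abbrev WeylAlgebraOne : Type := RingQuot WeylRel

/-! ### Noncommutative Kleinian singularities of type `D` -/

namespace KleinianD

/-- The constant `ρ = 2 q(-1/2)`. -/
noncomputable def rho (q : ℂ[X]) : ℂ := 2 * q.eval (-1 / 2)

/-- The numerator `-4 q(t) q(-t-1) + ρ²`. -/
noncomputable def numer (q : ℂ[X]) : ℂ[X] := -4 * q * q.comp (-X - 1) + C (rho q ^ 2)

/-- The polynomial `p(t) = (-4 q(t) q(-t-1) + ρ²) / (1 + 2t)²`. The division is exact, see
`KleinianD.p_mul`. -/
noncomputable def p (q : ℂ[X]) : ℂ[X] := numer q / (1 + 2 * X) ^ 2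

/-- The even part of `p`: `p(t) = p₀(t²) + p₁(t²) t`, see `KleinianD.p_eq`. -/
noncomputable def p0 (q : ℂ[X]) : ℂ[X] := (p q).contract 2

/-- The odd part of `p`: `p(t) = p₀(t²) + p₁(t²) t`, see `KleinianD.p_eq`. -/
noncomputable def p1 (q : ℂ[X]) : ℂ[X] := (p q).divX.contract 2

theorem p_mul (q : ℂ[X]) : p q * (1 + 2 * X) ^ 2 = numer q := by
  have hdvd : (1 + 2 * X : ℂ[X]) ^ 2 ∣ numer q := by
    obtain ⟨s, hs⟩ := X_sub_C_dvd_sub_C_eval (a := (-1 / 2 : ℂ)) (p := q)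
    have hC : (2 : ℂ[X]) * C (-1 / 2) = -1 := by
      rw [show (2 : ℂ[X]) = C 2 from rfl, ← C_mul]; norm_num
    have hq : q = C (q.eval (-1 / 2)) + (X - C (-1 / 2)) * s := by rw [← hs]; ring
    have hq' : q.comp (-X - 1)
        = C (q.eval (-1 / 2)) + (-X - 1 - C (-1 / 2)) * s.comp (-X - 1) := by
      have := congrArg (fun r : ℂ[X] => r.comp (-X - 1)) hq
      simpa using this
    have hroot : (s - s.comp (-X - 1)).IsRoot (-1 / 2) := by
      simp only [IsRoot, eval_sub, eval_comp, eval_neg, eval_X, eval_one]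
      norm_num
    obtain ⟨r, hr⟩ := dvd_iff_isRoot.mpr hroot
    refine ⟨s * s.comp (-X - 1) - C (q.eval (-1 / 2)) * r, ?_⟩
    unfold numer rho
    rw [hq']
    nth_rewrite 1 [hq]
    set a : ℂ[X] := C (q.eval (-1 / 2)) with ha
    have h4 : (C ((2 * q.eval (-1 / 2)) ^ 2) : ℂ[X]) = 4 * a ^ 2 := by
      rw [ha, mul_pow, C_mul, C_pow, C_pow]
      rw [show (C (2 : ℂ) : ℂ[X]) = 2 from rfl]; ring
    rw [h4]
    have h1 : s.comp (-X - 1) = s - (X - C (-1 / 2)) * r := by rw [← hr]; ring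
    rw [h1]
    generalize (C (-1 / 2) : ℂ[X]) = c at hC
    have h2 : (1 + 2 * X : ℂ[X]) = 2 * (X - c) := by linear_combination hC
    rw [h2, show (-X - 1 - c : ℂ[X]) = -(X - c) by linear_combination -hC]
    ring
  have hne : ((1 + 2 * X : ℂ[X]) ^ 2) ≠ 0 := by
    apply pow_ne_zero
    intro h
    have := congrArg (eval 0) h
    simp at this
  rw [mul_comm]
  exact EuclideanDomain.mul_div_cancel' hne hdvd

theorem p_eq (q : ℂ[X]) : p q = (p0 q).comp (X ^ 2) + (p1 q).comp (X ^ 2) * X := by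
  rw [← expand_eq_comp_X_pow, ← expand_eq_comp_X_pow]
  ext n
  rw [coeff_add]
  rcases Nat.even_or_odd' n with ⟨k, rfl | rfl⟩
  · rcases k with _ | k
    · simp [p0, coeff_expand, coeff_contract]
    · rw [show 2 * (k + 1) = (2 * k + 1) + 1 by ring, coeff_mul_X, coeff_expand two_pos,
        coeff_expand two_pos, if_pos (by omega), if_neg (by omega), p0, coeff_contract two_ne_zero,
        add_zero]
      congr 1
      omega
  · rw [coeff_mul_X, coeff_expand two_pos, coeff_expand two_pos, if_neg (by omega),
      if_pos (by omega), p1, coeff_contract two_ne_zero, coeff_divX, zero_add]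
    congr 1
    omega

/-- The three generators of `D(q)`. -/
inductive Gen : Type
  | u
  | v
  | w

/-- The generator `u` in the free algebra. -/
noncomputable abbrev u : FreeAlgebra ℂ Gen := FreeAlgebra.ι ℂ Gen.u

/-- The generator `v` in the free algebra. -/
noncomputable abbrev v : FreeAlgebra ℂ Gen := FreeAlgebra.ι ℂ Gen.v

/-- The generator `w` in the free algebra. -/
noncomputable abbrev w : FreeAlgebra ℂ Gen := FreeAlgebra.ι ℂ Gen.w

/-- The defining relations of `D(q)`; `[x, y] = x y - y x` is written out. -/
inductive Rel (q : ℂ[X]) : FreeAlgebra ℂ Gen → FreeAlgebra ℂ Gen → Prop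
  | uv : Rel q (u * v - v * u) (2 * w + v)
  | uw : Rel q (u * w - w * u) (2 * (v * u) + w + algebraMap ℂ _ (rho q))
  | vw : Rel q (v * w - w * v) (-v ^ 2 - aeval u (p1 q))
  | ww : Rel q (w ^ 2) (v ^ 2 * u + v * w + rho q • v + aeval u (p0 q))

end KleinianD

/-- The noncommutative Kleinian singularity `D(q)` of type `D`: the unital associative
`ℂ`-algebra with generators `u, v, w` and the relations `KleinianD.Rel q`. -/
abbrev KleinianDAlgebra (q : ℂ[X]) : Type := RingQuot (KleinianD.Rel q)

/-!
`D(q)` acts on rational functions of `x`: `u` is multiplication by `x²`, and `v`, `w` are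
combinations of `σ`, `1`, `σ⁻¹`, where `σ` is the translation by one. The filtration of `D(q)` by
degree in `v` and `w` has pieces of rank at most `2n + 1` over `ℂ[u]`, and reading off coefficients
of `σⁿ` shows that the representation is faithful. A ring with a filtration whose ranks grow
polynomially satisfies the left Ore condition, because `R s` and `R r` are too large to intersect
trivially; an involution gives the right one. Inside the skew field of fractions of `ℂ(x)[σ, σ⁻¹]`
put `Y = x⁻¹ (σ - σ⁻¹)` and `Z = σ + σ⁻¹`. Then `Y Z - Z Y = Y²`, so that `Z` and `Y⁻¹` generate
a copy of the Weyl algebra. Moreover `u Y² = Z² - 4 - Z Y`, and `v`, `w` are obtained from `Y`,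
`Z` by an invertible affine transformation with coefficients in `ℂ(u)`, built from the even and odd
parts of `q(t) (2t - 1)`. Hence `u, v, w` and `Y⁻¹, Z` generate the same division ring.
-/

section Growth

/-- The elements of a ring whose right multiplication shifts the filtration `V` by a bounded
amount, as a subring. -/
def rightShifters {k R : Type*} [Ring k] [Ring R] [Module k R] (V : ℕ →o Submodule k R) :
    Subring R where
  carrier := {r | ∃ c, ∀ n, ∀ x ∈ V n, x * r ∈ V (n + c)}
  zero_mem' := ⟨0, fun n x _ => by simp⟩
  one_mem' := ⟨0, fun n x hx => by simpa⟩
  add_mem' := by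
    rintro r s ⟨a, ha⟩ ⟨b, hb⟩
    refine ⟨a + b, fun n x hx => ?_⟩
    rw [mul_add]
    exact add_mem (V.mono (by omega) (ha n x hx)) (V.mono (by omega) (hb n x hx))
  mul_mem' := by
    rintro r s ⟨a, ha⟩ ⟨b, hb⟩
    refine ⟨a + b, fun n x hx => ?_⟩
    rw [← mul_assoc, ← add_assoc]
    exact hb _ _ (ha n x hx)
  neg_mem' := by
    rintro r ⟨a, ha⟩
    refine ⟨a, fun n x hx => ?_⟩
    rw [mul_neg]
    exact neg_mem (ha n x hx)

theorem rightShifters_eq_top_of_adjoin_eq_top {F k R : Type*} [CommSemiring F] [Ring k]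
    [Ring R] [Module k R] [Algebra F R] [SMul F k] [IsScalarTower F k R]
    {V : ℕ →o Submodule k R} {s : Set R} (hs : Algebra.adjoin F s = ⊤)
    (h : s ⊆ rightShifters V) : rightShifters V = ⊤ := by
  refine eq_top_iff.mpr fun r _ => ?_
  have hr : r ∈ Algebra.adjoin F s := hs ▸ Algebra.mem_top
  clear * - hr h
  induction hr using Algebra.adjoin_induction with
  | mem x hx => exact h hx
  | algebraMap c =>
    refine ⟨0, fun n x hx => ?_⟩
    rw [← Algebra.commutes, ← Algebra.smul_def]
    exact (V n).smul_of_tower_mem c hx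
  | add x y _ _ hx hy => exact add_mem hx hy
  | mul x y _ _ hx hy => exact mul_mem hx hy

theorem exists_mul_pow_lt_two_pow (C d c : ℕ) : ∃ m : ℕ, C * (c * m + 1) ^ d < 2 ^ m := by
  have h := (isLittleO_pow_const_const_pow_of_one_lt (R := ℝ) d one_lt_two).def
    (c := ((2 * C * (c + 1) ^ d + 1 : ℕ) : ℝ)⁻¹) (by positivity)
  obtain ⟨n, hn, hn_pos⟩ := (h.and (Filter.eventually_ge_atTop 1)).exists
  obtain ⟨m, rfl⟩ := Nat.exists_eq_add_of_le' hn_pos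
  rw [le_inv_mul_iff₀ (by positivity), Real.norm_of_nonneg (by positivity),
    Real.norm_of_nonneg (by positivity)] at hn
  have hle : (2 * C * (c + 1) ^ d + 1) * (m + 1) ^ d ≤ 2 ^ (m + 1) := by exact_mod_cast hn
  have hpow : (c * m + 1) ^ d ≤ (c + 1) ^ d * (m + 1) ^ d := by
    rw [← mul_pow]
    exact Nat.pow_le_pow_left (by nlinarith) d
  have hpos : 0 < (m + 1) ^ d := by positivity
  refine ⟨m, ?_⟩
  rw [pow_succ] at hle
  nlinarith [Nat.mul_le_mul_left C hpow]

universe v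

variable {k : Type*} {R : Type v} [Ring k] [HasRankNullity.{v} k] [Ring R] [NoZeroDivisors R]
  [Module k R] [IsScalarTower k R R] {V : ℕ →o Submodule k R}

/-- Without a common left multiple of `r` and `s`, the sum `R r + R s` is direct, so each `V n`
has two independent copies in a later `V (n + c)`. -/
theorem exists_two_mul_rank_le_of_no_common_left_multiple (hV : rightShifters V = ⊤)
    {r s : R} (hs : s ≠ 0) (hrs : ∀ r' s' : R, s' ≠ 0 → s' * r ≠ r' * s) :
    ∃ c, ∀ n, 2 * Module.rank k (V n) ≤ Module.rank k (V (n + c)) := by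
  have hr : r ≠ 0 := fun hr => by
    cases subsingleton_or_nontrivial R
    · exact hs (Subsingleton.elim _ _)
    · exact hrs 0 1 one_ne_zero (by simp [hr])
  obtain ⟨a, ha⟩ : r ∈ rightShifters V := hV ▸ Subring.mem_top r
  obtain ⟨b, hb⟩ : s ∈ rightShifters V := hV ▸ Subring.mem_top s
  refine ⟨a + b, fun n => ?_⟩
  have rank_map (t : R) (ht : t ≠ 0) :
      Module.rank k ((V n).map (LinearMap.mulRight k t)) = Module.rank k (V n) :=
    rank_map_eq (mul_left_injective₀ ht) _
  have hdisj : (V n).map (LinearMap.mulRight k r) ⊓ (V n).map (LinearMap.mulRight k s) = ⊥ := by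
    rw [eq_bot_iff]
    rintro _ ⟨⟨x, -, rfl⟩, y, -, hxy⟩
    by_contra hx
    exact hrs y x (fun h0 => hx (by simp [h0])) hxy.symm
  have : Nontrivial k := nontrivial_of_hasRankNullity.{v} k
  have hsum := Submodule.rank_sup_add_rank_inf_eq
    ((V n).map (LinearMap.mulRight k r)) ((V n).map (LinearMap.mulRight k s))
  rw [hdisj, rank_bot, add_zero, rank_map r hr, rank_map s hs, ← two_mul] at hsum
  refine hsum.symm.trans_le (Submodule.rank_mono (sup_le ?_ ?_))
  · rintro _ ⟨x, hx, rfl⟩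
    exact V.mono (by omega) (ha n x hx)
  · rintro _ ⟨x, hx, rfl⟩
    exact V.mono (by omega) (hb n x hx)

theorem exists_common_left_multiple_of_polynomial_growth [IsDomain k] [Nontrivial R]
    [Module.IsTorsionFree k R]
    (hV : rightShifters V = ⊤) (hone : 1 ∈ V 0) (C d : ℕ)
    (hgrowth : ∀ n, Module.rank k (V n) ≤ (C * (n + 1) ^ d : ℕ)) (r s : R) (hs : s ≠ 0) :
    ∃ r' s' : R, s' ≠ 0 ∧ s' * r = r' * s := by
  by_contra! hrs
  obtain ⟨c, hc⟩ := exists_two_mul_rank_le_of_no_common_left_multiple hV hs hrs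
  have hpow (m : ℕ) : ((2 ^ m : ℕ) : Cardinal) ≤ Module.rank k (V (c * m)) := by
    induction m with
    | zero =>
      have : Nontrivial (V (c * 0)) := ⟨⟨1, hone⟩, 0, fun h => one_ne_zero (congrArg Subtype.val h)⟩
      simpa using Cardinal.one_le_iff_pos.mpr (rank_pos (R := k) (M := V (c * 0)))
    | succ m ih =>
      calc ((2 ^ (m + 1) : ℕ) : Cardinal) = 2 * (2 ^ m : ℕ) := by push_cast; ring
        _ ≤ 2 * Module.rank k (V (c * m)) := by gcongr
        _ ≤ Module.rank k (V (c * (m + 1))) := hc _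
  obtain ⟨m, hm⟩ := exists_mul_pow_lt_two_pow C d c
  exact absurd (Nat.cast_le.mp ((hpow m).trans (hgrowth _))) (not_le.mpr hm)

end Growth

theorem isOreDomain_of_involution {F R : Type*} [CommSemiring F] [Ring R] [IsDomain R]
    [Algebra F R] (hleft : ∀ r s : R, s ≠ 0 → ∃ r' s' : R, s' ≠ 0 ∧ s' * r = r' * s)
    (τ : R →ₐ[F] Rᵐᵒᵖ) {t : Set R} (ht : Algebra.adjoin F t = ⊤)
    (hτ : ∀ x ∈ t, (τ (τ x).unop).unop = x) : IsOreDomain R where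
  left_ore := hleft
  right_ore r s hs := by
    have hinv (x : R) : (τ (τ x).unop).unop = x := by
      have hx : x ∈ Algebra.adjoin F t := ht ▸ Algebra.mem_top
      induction hx using Algebra.adjoin_induction with
      | mem x hx => exact hτ x hx
      | algebraMap c => simp [MulOpposite.algebraMap_apply]
      | add x y _ _ hx hy => simp [hx, hy]
      | mul x y _ _ hx hy => simp [hx, hy]
    have hinj {x : R} (hx : x ≠ 0) : (τ x).unop ≠ 0 :=
      fun h => hx (by simpa [h] using (hinv x).symm)
    obtain ⟨r', s', hs', h⟩ := hleft (τ r).unop (τ s).unop (hinj hs)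
    refine ⟨(τ r').unop, (τ s').unop, hinj hs', ?_⟩
    simpa [hinv] using congrArg (fun x => (τ x).unop) h

section SkewMonoidAlgebraDomain

variable {K G : Type*} [Semiring K]

theorem skewMonoidAlgebra_coeff_mul_of_uniqueMul [Monoid G] [MulSemiringAction G K]
    {f g : SkewMonoidAlgebra K G} {a b : G} (h : UniqueMul f.support g.support a b) :
    (f * g).coeff (a * b) = f.coeff a * a • g.coeff b := by
  classical
  rw [SkewMonoidAlgebra.coeff_mul]
  simp_rw [SkewMonoidAlgebra.sum_def, Finsupp.sum, SkewMonoidAlgebra.support_coeff]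
  rw [← Finset.sum_product']
  refine (Finset.sum_eq_single (a, b) ?_ ?_).trans (if_pos rfl)
  · rintro ⟨c, d⟩ hcd hne
    rw [Finset.mem_product] at hcd
    refine if_neg fun h' => hne ?_
    obtain ⟨rfl, rfl⟩ := h hcd.1 hcd.2 h'
    rfl
  · intro hab
    rw [Finset.mem_product, not_and_or, SkewMonoidAlgebra.notMem_support_iff,
      SkewMonoidAlgebra.notMem_support_iff] at hab
    rcases hab with h0 | h0 <;> simp [h0]

instance skewMonoidAlgebra_noZeroDivisors [NoZeroDivisors K] [Group G] [UniqueProds G]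
    [MulSemiringAction G K] : NoZeroDivisors (SkewMonoidAlgebra K G) where
  eq_zero_or_eq_zero_of_mul_eq_zero {f g} hfg := by
    by_contra! hne
    obtain ⟨a, ha, b, hb, hab⟩ := UniqueProds.uniqueMul_of_nonempty
      (Finset.nonempty_iff_ne_empty.mpr (by simpa using hne.1) : f.support.Nonempty)
      (Finset.nonempty_iff_ne_empty.mpr (by simpa using hne.2) : g.support.Nonempty)
    rw [SkewMonoidAlgebra.mem_support_iff] at ha hb
    refine mul_ne_zero ha (fun h => hb ((smul_eq_zero_iff_eq a).mp h)) ?_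
    rw [← skewMonoidAlgebra_coeff_mul_of_uniqueMul hab, hfg, SkewMonoidAlgebra.coeff_zero,
      Finsupp.zero_apply]

end SkewMonoidAlgebraDomain

/-- The twisted Laurent polynomial ring `K[σ, σ⁻¹]`, in which `σ a = (σ • a) σ`. -/
abbrev TwistedLaurent (K : Type*) [Semiring K] [MulSemiringAction (Multiplicative ℤ) K] : Type _ :=
  SkewMonoidAlgebra K (Multiplicative ℤ)

namespace TwistedLaurent

open Multiplicative (ofAdd toAdd)

section Semiring

variable {K : Type*} [Semiring K] [MulSemiringAction (Multiplicative ℤ) K]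

/-- The monomial `a σⁿ`. -/
noncomputable def term (n : ℤ) (a : K) : TwistedLaurent K :=
  SkewMonoidAlgebra.single (ofAdd n) a

theorem term_mul_term (m n : ℤ) (a b : K) :
    term m a * term n b = term (m + n) (a * ofAdd m • b) :=
  SkewMonoidAlgebra.single_mul_single

theorem term_add (n : ℤ) (a b : K) : term n (a + b) = term n a + term n b :=
  SkewMonoidAlgebra.single_add ..

theorem term_zero_right (n : ℤ) : term n (0 : K) = 0 :=
  SkewMonoidAlgebra.single_zero _

theorem smul_term (a b : K) (n : ℤ) : a • term n b = term n (a * b) :=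
  SkewMonoidAlgebra.smul_single ..

theorem coeff_term (n m : ℤ) (a : K) :
    (term n a).coeff (ofAdd m) = if n = m then a else 0 := by
  classical
  rw [term, SkewMonoidAlgebra.coeff_single_apply]
  simp

variable (K) in
/-- The twisted Laurent polynomials of degree at most `n`. -/
def degreeLE (n : ℤ) : Submodule K (TwistedLaurent K) where
  carrier := {f | ∀ i, n < i → f.coeff (ofAdd i) = 0}
  zero_mem' _ _ := rfl
  add_mem' hf hg i hi := by
    rw [SkewMonoidAlgebra.coeff_add, Finsupp.add_apply, hf i hi, hg i hi, add_zero]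
  smul_mem' a f hf i hi := by
    rw [SkewMonoidAlgebra.coeff_smul, Finsupp.smul_apply, hf i hi, smul_zero]

variable {m n : ℤ} {f g : TwistedLaurent K}

theorem degreeLE_mono (h : m ≤ n) : degreeLE K m ≤ degreeLE K n :=
  fun _ hf i hi => hf i (h.trans_lt hi)

theorem term_mem_degreeLE (h : m ≤ n) (a : K) : term m a ∈ degreeLE K n := fun i hi => by
  rw [coeff_term, if_neg (h.trans_lt hi).ne]

theorem toAdd_le_of_mem_support (hf : f ∈ degreeLE K m) {a : Multiplicative ℤ}
    (ha : a ∈ f.support) : toAdd a ≤ m := by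
  by_contra! h
  exact SkewMonoidAlgebra.mem_support_iff.mp ha (hf _ h)

theorem mul_mem_degreeLE (hf : f ∈ degreeLE K m) (hg : g ∈ degreeLE K n) :
    f * g ∈ degreeLE K (m + n) := by
  classical
  intro i hi
  by_contra hne
  obtain ⟨a, ha, b, hb, hab⟩ := Finset.mem_mul.mp
    (SkewMonoidAlgebra.support_mul f g (SkewMonoidAlgebra.mem_support_iff.mpr hne))
  have := toAdd_le_of_mem_support hf ha
  have := toAdd_le_of_mem_support hg hb
  have : toAdd a + toAdd b = i := congrArg toAdd hab
  omega

theorem coeff_add_mul_of_mem_degreeLE (hf : f ∈ degreeLE K m) (hg : g ∈ degreeLE K n) :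
    (f * g).coeff (ofAdd (m + n)) = f.coeff (ofAdd m) * ofAdd m • g.coeff (ofAdd n) := by
  refine skewMonoidAlgebra_coeff_mul_of_uniqueMul fun a b ha hb hab => ?_
  have := toAdd_le_of_mem_support hf ha
  have := toAdd_le_of_mem_support hg hb
  have : toAdd a + toAdd b = m + n := congrArg toAdd hab
  exact ⟨toAdd.injective (show toAdd a = m by omega), toAdd.injective (show toAdd b = n by omega)⟩

end Semiring

section Field

variable {K : Type*} [Field K] [MulSemiringAction (Multiplicative ℤ) K]

noncomputable instance instIsDomain : IsDomain (TwistedLaurent K) := NoZeroDivisors.to_isDomain _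

open Classical in
variable (K) in
/-- The span of the powers `σⁱ` with `-n ≤ i ≤ n`, as a filtration by left `K`-subspaces. -/
noncomputable def bandFiltration : ℕ →o Submodule K (TwistedLaurent K) where
  toFun n := Submodule.span K
    ((Finset.Icc (-n : ℤ) n).image fun i => term i (1 : K) : Finset (TwistedLaurent K))
  monotone' m n h := by
    refine Submodule.span_mono (Finset.coe_subset.mpr (Finset.image_subset_image ?_))
    exact Finset.Icc_subset_Icc (by omega) (by omega)

theorem term_mem_bandFiltration {i : ℤ} {n : ℕ} (hi : i.natAbs ≤ n) (a : K) :
    term i a ∈ bandFiltration K n := by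
  classical
  rw [← mul_one a, ← smul_term]
  refine Submodule.smul_mem _ _ (Submodule.subset_span (Finset.mem_coe.mpr ?_))
  exact Finset.mem_image_of_mem _ (Finset.mem_Icc.mpr (by omega))

theorem rank_bandFiltration_le (n : ℕ) :
    Module.rank K (bandFiltration K n) ≤ (2 * (n + 1) ^ 1 : ℕ) := by
  classical
  refine (rank_span_finset_le _).trans (Nat.cast_le.mpr (Finset.card_image_le.trans ?_))
  rw [Int.card_Icc, pow_one]
  omega

theorem rightShifters_bandFiltration : rightShifters (bandFiltration K) = ⊤ := by
  classical
  refine eq_top_iff.mpr fun r _ => ?_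
  induction r using SkewMonoidAlgebra.induction_on with
  | zero => exact zero_mem _
  | add f g hf hg => exact add_mem (hf trivial) (hg trivial)
  | single g a =>
    refine ⟨(toAdd g).natAbs, fun n => (Submodule.span_le (p := (bandFiltration K _).comap
      (LinearMap.mulRight K (SkewMonoidAlgebra.single g a)))).mpr ?_⟩
    intro x hx
    obtain ⟨i, hi, rfl⟩ := Finset.mem_image.mp (Finset.mem_coe.mp hx)
    rw [Finset.mem_Icc] at hi
    have hmul := term_mul_term i (toAdd g) 1 a
    rw [SetLike.mem_coe, Submodule.mem_comap, LinearMap.mulRight_apply]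
    exact hmul ▸ term_mem_bandFiltration (by omega) _

theorem exists_common_left_multiple (r s : TwistedLaurent K) (hs : s ≠ 0) :
    ∃ r' s' : TwistedLaurent K, s' ≠ 0 ∧ s' * r = r' * s :=
  exists_common_left_multiple_of_polynomial_growth rightShifters_bandFiltration
    (term_mem_bandFiltration (i := 0) le_rfl 1) 2 1 rank_bandFiltration_le r s hs

noncomputable instance instOreSet : OreLocalization.OreSet (TwistedLaurent K)⁰ :=
  (OreLocalization.nonempty_oreSet_iff_of_noZeroDivisors.mpr fun r s => by
    obtain ⟨r', s', hs', h⟩ := exists_common_left_multiple r s (nonZeroDivisors.ne_zero s.2)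
    exact ⟨r', ⟨s', mem_nonZeroDivisors_of_ne_zero hs'⟩, h⟩).some

end Field

end TwistedLaurent

namespace SkewFrac

variable {k R K : Type*} [CommRing k] [Ring R] [IsOreDomain R] [Algebra k R] [DivisionRing K]
  [Algebra k K]

/-- The extension of an injective homomorphism into a division ring to the skew field of
fractions. -/
noncomputable def lift (f : R →ₐ[k] K) (hf : Function.Injective f) : SkewFrac R →ₐ[k] K :=
  let units : R⁰ →* Kˣ :=
    { toFun := fun s => Units.mk0 (f s) ((map_ne_zero_iff f hf).mpr (nonZeroDivisors.ne_zero s.2))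
      map_one' := Units.ext (by simp)
      map_mul' := fun s t => Units.ext (by simp) }
  { OreLocalization.universalHom (f : R →+* K) units (fun _ => rfl) with
    commutes' := fun r => (OreLocalization.universalHom_commutes (f : R →+* K) units
      (fun _ => rfl)).trans (f.commutes r) }

variable {f : R →ₐ[k] K} {hf : Function.Injective f}

theorem lift_oreDiv (r : R) (s : R⁰) : lift f hf (r /ₒ s) = (f s)⁻¹ * f r := by
  have hs : f s ≠ 0 := (map_ne_zero_iff f hf).mpr (nonZeroDivisors.ne_zero s.2)
  change ((Units.mk0 (f s) hs)⁻¹ : Kˣ) * f r = _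
  rw [Units.val_inv_eq_inv_val, Units.val_mk0]

theorem lift_oreDiv_one (r : R) : lift f hf (r /ₒ 1) = f r := by
  rw [lift_oreDiv, OneMemClass.coe_one, map_one, inv_one, one_mul]

end SkewFrac

section DivisionClosure

variable (k : Type*) {K : Type*} [CommRing k] [DivisionRing K] [Algebra k K]

/-- The smallest division subring containing `s` and the scalars from `k`. Mathlib's `Subfield` of
a division ring need not be commutative. -/
def divisionClosure (s : Set K) : Subfield K :=
  Subfield.closure (Set.range (algebraMap k K) ∪ s)

variable {k} {s : Set K}

theorem subset_divisionClosure : s ⊆ divisionClosure k s :=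
  Set.subset_union_right.trans Subfield.subset_closure

theorem algebraMap_mem_divisionClosure (c : k) : algebraMap k K c ∈ divisionClosure k s :=
  Subfield.subset_closure (Or.inl ⟨c, rfl⟩)

theorem divisionClosure_le {B : Subfield K} (hk : ∀ c : k, algebraMap k K c ∈ B)
    (hs : s ⊆ B) : divisionClosure k s ≤ B :=
  Subfield.closure_le.mpr (Set.union_subset (Set.range_subset_iff.mpr hk) hs)

theorem divisionClosure_le_divisionClosure {t : Set K} (h : s ⊆ divisionClosure k t) :
    divisionClosure k s ≤ divisionClosure k t :=
  divisionClosure_le algebraMap_mem_divisionClosure h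

theorem aeval_mem_divisionClosure {x : K} (hx : x ∈ divisionClosure k s) (p : k[X]) :
    aeval x p ∈ divisionClosure k s := by
  rw [aeval_eq_sum_range]
  refine sum_mem fun i _ => ?_
  rw [Algebra.smul_def]
  exact mul_mem (algebraMap_mem_divisionClosure _) (pow_mem hx i)

variable {R : Type*} [Ring R] [IsOreDomain R] [Algebra k R]

theorem range_lift_eq_divisionClosure {f : R →ₐ[k] K} (hf : Function.Injective f) {t : Set R}
    (ht : Algebra.adjoin k t = ⊤) :
    Set.range (SkewFrac.lift f hf) = divisionClosure k (f '' t) := by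
  apply subset_antisymm
  · have hmem (r : R) : f r ∈ divisionClosure k (f '' t) := by
      have hr : r ∈ Algebra.adjoin k t := ht ▸ Algebra.mem_top
      induction hr using Algebra.adjoin_induction with
      | mem x hx => exact subset_divisionClosure ⟨x, hx, rfl⟩
      | algebraMap c => exact f.commutes c ▸ algebraMap_mem_divisionClosure c
      | add x y _ _ hx hy => exact map_add f x y ▸ add_mem hx hy
      | mul x y _ _ hx hy => exact map_mul f x y ▸ mul_mem hx hy
    rintro _ ⟨x, rfl⟩
    induction x using OreLocalization.ind with
    | _ r s =>
      rw [SkewFrac.lift_oreDiv]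
      exact mul_mem (inv_mem (hmem s)) (hmem r)
  · refine divisionClosure_le (B := (SkewFrac.lift f hf).toRingHom.fieldRange)
      (fun c => ⟨algebraMap k _ c, AlgHom.commutes _ c⟩) ?_
    rintro _ ⟨r, -, rfl⟩
    exact ⟨r /ₒ 1, SkewFrac.lift_oreDiv_one r⟩

theorem nonempty_skewFrac_algEquiv_of_divisionClosure_eq {R' : Type*} [Ring R'] [IsOreDomain R']
    [Algebra k R'] {f : R →ₐ[k] K} (hf : Function.Injective f) {g : R' →ₐ[k] K}
    (hg : Function.Injective g) {t : Set R} {t' : Set R'} (ht : Algebra.adjoin k t = ⊤)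
    (ht' : Algebra.adjoin k t' = ⊤)
    (h : divisionClosure k (f '' t) = divisionClosure k (g '' t')) :
    Nonempty (SkewFrac R ≃ₐ[k] SkewFrac R') := by
  have hrange : (SkewFrac.lift f hf).range = (SkewFrac.lift g hg).range := by
    apply SetLike.coe_injective
    rw [AlgHom.coe_range, AlgHom.coe_range, range_lift_eq_divisionClosure hf ht,
      range_lift_eq_divisionClosure hg ht', h]
  exact ⟨((AlgEquiv.ofInjective (SkewFrac.lift f hf) (SkewFrac.lift f hf).toRingHom.injective).trans
    (Subalgebra.equivOfEq _ _ hrange)).trans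
    (AlgEquiv.ofInjective (SkewFrac.lift g hg) (SkewFrac.lift g hg).toRingHom.injective).symm⟩

end DivisionClosure

/-- Cramer's rule, with coefficients in a commutative ring acting through `φ`. -/
theorem mem_subfield_of_det_ne_zero {A K : Type*} [CommRing A] [DivisionRing K] (φ : A →+* K)
    {B : Subfield K} (hφ : ∀ a, φ a ∈ B) {a b c d : A} (hdet : φ (a * d - b * c) ≠ 0) {y z : K}
    (h₁ : φ a * y + φ b * z ∈ B) (h₂ : φ c * y + φ d * z ∈ B) : y ∈ B ∧ z ∈ B := by
  have mem_of_det_mul_mem {x : K} (hx : φ (a * d - b * c) * x ∈ B) : x ∈ B :=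
    inv_mul_cancel_left₀ hdet x ▸ mul_mem (inv_mem (hφ (a * d - b * c))) hx
  constructor <;> apply mem_of_det_mul_mem
  · have hy : φ (a * d - b * c) * y
        = φ d * (φ a * y + φ b * z) - φ b * (φ c * y + φ d * z) := by
      simp only [mul_add, ← mul_assoc, ← map_mul, map_sub, sub_mul, mul_comm d]
      abel
    exact hy ▸ sub_mem (mul_mem (hφ d) h₁) (mul_mem (hφ b) h₂)
  · have hz : φ (a * d - b * c) * z
        = φ a * (φ c * y + φ d * z) - φ c * (φ a * y + φ b * z) := by
      simp only [mul_add, ← mul_assoc, ← map_mul, map_sub, sub_mul, mul_comm c]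
      abel
    exact hz ▸ sub_mem (mul_mem (hφ a) h₂) (mul_mem (hφ c) h₁)

theorem eq_zero_of_closed_under_derivative {A : Type*} [Semiring A] [IsAddTorsionFree A]
    {P : A[X] → Prop} (hderiv : ∀ a, P a → P (derivative a)) (hC : ∀ c, P (C c) → c = 0) {a : A[X]}
    (ha : P a) : a = 0 := by
  induction hn : a.natDegree using Nat.strong_induction_on generalizing a with
  | _ n ih =>
  have hconst : a.natDegree = 0 := by
    by_contra hne
    exact hne (derivative_eq_zero.mp
      (ih _ (hn ▸ natDegree_derivative_lt hne) (hderiv a ha) rfl))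
  rw [eq_C_of_natDegree_eq_zero hconst] at ha ⊢
  rw [hC _ ha, C_0]

theorem op_neg_commutator_eq_one {R : Type*} [Ring R] {y z : R}
    (h : y * z - z * y = 1) :
    MulOpposite.op (-y) * MulOpposite.op z - MulOpposite.op z * MulOpposite.op (-y) = 1 :=
  MulOpposite.unop_injective (by
    rw [MulOpposite.unop_sub, MulOpposite.unop_mul, MulOpposite.unop_mul, MulOpposite.unop_one]
    simp [← h, sub_eq_neg_add, add_comm])

section WeylPair

variable {k R : Type*} [CommRing k] [Ring R] [Algebra k R] {y z : R}

theorem mul_aeval_of_commutator_eq_one (h : y * z - z * y = 1) (a : k[X]) :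
    y * aeval z a = aeval z a * y + aeval z (derivative a) := by
  induction a using Polynomial.induction_on with
  | C c => simp [Algebra.commutes]
  | add a b ha hb => simp only [map_add, mul_add, add_mul, ha, hb]; abel
  | monomial n c ih =>
    rw [pow_succ, ← mul_assoc]
    generalize C c * X ^ n = b at ih
    rw [derivative_mul, derivative_X, map_add, map_mul, map_mul, aeval_X, mul_one, ← mul_assoc, ih,
      add_mul, mul_assoc, sub_eq_iff_eq_add.mp h, mul_add, mul_one, mul_assoc]
    abel

/-- The normally ordered element `∑ aⱼ(z) yʲ` attached to `∑ aⱼ Yʲ`. -/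
noncomputable def normallyOrdered (y z : R) : k[X][X] →+ R :=
  eval₂AddMonoidHom (aeval z).toRingHom y

theorem normallyOrdered_monomial (n : ℕ) (a : k[X]) :
    normallyOrdered y z (monomial n a) = aeval z a * y ^ n :=
  eval₂_monomial ..

theorem normallyOrdered_C (a : k[X]) : normallyOrdered y z (C a) = aeval z a :=
  eval₂_C ..

theorem normallyOrdered_C_mul (a : k[X]) (p : k[X][X]) :
    normallyOrdered y z (C a * p) = aeval z a * normallyOrdered y z p := by
  induction p using Polynomial.induction_on' with
  | add p p' hp hp' => simp only [mul_add, map_add, hp, hp']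
  | monomial n b => simp only [C_mul_monomial, normallyOrdered_monomial, map_mul, mul_assoc]

theorem normallyOrdered_mul_X (p : k[X][X]) :
    normallyOrdered y z (p * X) = normallyOrdered y z p * y :=
  eval₂_mul_X ..

theorem normallyOrdered_mul (h : y * z - z * y = 1) (p : k[X][X]) :
    normallyOrdered y z p * z = normallyOrdered y z (C X * p + derivative p) := by
  induction p using Polynomial.induction_on' with
  | add p p' hp hp' =>
    rw [map_add, add_mul, hp, hp', ← map_add, derivative_add]
    congr 1
    ring
  | monomial n a =>
    have hpow : y ^ n * z = z * y ^ n + n * y ^ (n - 1) := by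
      have hneg := mul_aeval_of_commutator_eq_one (k := k) (y := -z) (z := y)
        (by rw [← h]; noncomm_ring) (X ^ n)
      simp only [map_pow, aeval_X, derivative_X_pow, map_mul, map_natCast] at hneg
      rw [← sub_eq_iff_eq_add', ← sub_eq_iff_eq_add'.mpr hneg]
      noncomm_ring
    have hcomm : z * aeval z a = aeval z a * z := by
      simpa using congrArg (aeval z) (mul_comm X a)
    simp only [map_add, normallyOrdered_C_mul, derivative_monomial, normallyOrdered_monomial,
      aeval_X, map_mul, map_natCast]
    rw [mul_assoc, hpow, mul_add, ← mul_assoc z, hcomm]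
    simp only [mul_assoc]

theorem injective_aeval_of_commutator_eq_one [IsAddTorsionFree k] [FaithfulSMul k R]
    (h : y * z - z * y = 1) : Function.Injective (aeval z : k[X] → R) := by
  refine (injective_iff_map_eq_zero _).mpr fun a ha =>
    eq_zero_of_closed_under_derivative (P := fun a => aeval z a = 0) (fun a ha => ?_)
      (fun c hc => ?_) ha
  · simpa [ha] using (mul_aeval_of_commutator_eq_one h a).symm
  · rwa [aeval_C, FaithfulSMul.algebraMap_eq_zero_iff] at hc

theorem normallyOrdered_injective [NoZeroDivisors k] [CharZero k] [FaithfulSMul k R]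
    (h : y * z - z * y = 1) :
    Function.Injective (normallyOrdered y z : k[X][X] → R) := by
  refine (injective_iff_map_eq_zero _).mpr fun p hp =>
    eq_zero_of_closed_under_derivative (P := fun p => normallyOrdered y z p = 0) (fun p hp => ?_)
      (fun a ha => ?_) hp
  · simpa [normallyOrdered_C_mul, hp] using (normallyOrdered_mul h p).symm
  · rw [normallyOrdered_C] at ha
    exact injective_aeval_of_commutator_eq_one h (by rw [ha, map_zero])

end WeylPair

namespace WeylAlgebraOne

/-- The generator `x` of the first Weyl algebra. -/
noncomputable def x : WeylAlgebraOne := RingQuot.mkAlgHom ℂ WeylRel (FreeAlgebra.ι ℂ WeylGen.x)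

/-- The generator `d` of the first Weyl algebra. -/
noncomputable def d : WeylAlgebraOne := RingQuot.mkAlgHom ℂ WeylRel (FreeAlgebra.ι ℂ WeylGen.d)

theorem commutator_d_x : d * x - x * d = 1 := by
  simpa [x, d] using RingQuot.mkAlgHom_rel ℂ WeylRel.comm

theorem adjoin_generators : Algebra.adjoin ℂ {x, d} = ⊤ := by
  have hgen : RingQuot.mkAlgHom ℂ WeylRel '' Set.range (FreeAlgebra.ι ℂ) ⊆ {x, d} := by
    rintro _ ⟨_, ⟨_ | _, rfl⟩, rfl⟩
    exacts [Or.inl rfl, Or.inr rfl]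
  refine top_le_iff.mp (le_trans ?_ (Algebra.adjoin_mono hgen))
  rw [← AlgHom.map_adjoin, FreeAlgebra.adjoin_range_ι, Algebra.map_top]
  exact ((AlgHom.range_eq_top _).mpr (RingQuot.mkAlgHom_surjective ℂ WeylRel)).ge

/-- The Weyl algebra as a left `ℂ[x]`-module. -/
noncomputable instance : Module ℂ[X] WeylAlgebraOne :=
  Module.compHom _ (aeval x : ℂ[X] →ₐ[ℂ] WeylAlgebraOne).toRingHom

theorem smul_def (a : ℂ[X]) (r : WeylAlgebraOne) : a • r = aeval x a * r := rfl

instance : IsScalarTower ℂ[X] WeylAlgebraOne WeylAlgebraOne where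
  smul_assoc a r s := mul_assoc (aeval x a) r s

instance : IsScalarTower ℂ ℂ[X] WeylAlgebraOne where
  smul_assoc c a r := by simp only [smul_def, map_smul, smul_mul_assoc]

/-- Normal ordering `∑ aⱼ(x) dʲ` as a map of left `ℂ[x]`-modules. -/
noncomputable def normalOrdering : ℂ[X][X] →ₗ[ℂ[X]] WeylAlgebraOne where
  __ := normallyOrdered d x
  map_smul' a p := (congrArg (normallyOrdered d x) (smul_eq_C_mul a)).trans
    (normallyOrdered_C_mul a p)

/-- The differential operators of order at most `n`. -/
noncomputable def orderFiltration : ℕ →o Submodule ℂ[X] WeylAlgebraOne where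
  toFun n := (degreeLT ℂ[X] (n + 1)).map normalOrdering
  monotone' _ _ h := Submodule.map_mono (degreeLT_mono (Nat.add_le_add_right h 1))

theorem one_mem_orderFiltration : 1 ∈ orderFiltration 0 :=
  ⟨C 1, mem_degreeLT.mpr (by simp), (normallyOrdered_C 1).trans (map_one _)⟩

theorem rank_orderFiltration_le (n : ℕ) :
    Module.rank ℂ[X] (orderFiltration n) ≤ (1 * (n + 1) ^ 1 : ℕ) := by
  refine (rank_map_le normalOrdering (degreeLT ℂ[X] (n + 1))).trans ?_
  rw [(degreeLTEquiv ℂ[X] (n + 1)).rank_eq, rank_fin_fun, one_mul, pow_one]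

theorem rightShifters_orderFiltration : rightShifters orderFiltration = ⊤ := by
  refine rightShifters_eq_top_of_adjoin_eq_top adjoin_generators ?_
  rintro _ (rfl | rfl) <;> refine ⟨1, fun n r hr => ?_⟩ <;> obtain ⟨p, hp, rfl⟩ := hr
  · have hp' : p ∈ degreeLT ℂ[X] (n + 1 + 1) := degreeLT_mono (Nat.le_succ _) hp
    exact ⟨C X * p + derivative p, add_mem (smul_eq_C_mul X (p := p) ▸ Submodule.smul_mem _ X hp')
      (mem_degreeLT.mpr (degree_derivative_le.trans_lt (mem_degreeLT.mp hp'))),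
      (normallyOrdered_mul commutator_d_x p).symm⟩
  · refine ⟨p * X, mem_degreeLT.mpr ?_, normallyOrdered_mul_X p⟩
    rw [degree_mul_X, Nat.cast_succ]
    exact WithBot.add_lt_add_right (by simp) (mem_degreeLT.mp hp)

theorem surjective_normallyOrdered :
    Function.Surjective (normallyOrdered d x : ℂ[X][X] → WeylAlgebraOne) := fun r => by
  have hr : r ∈ rightShifters orderFiltration := rightShifters_orderFiltration ▸ Subring.mem_top r
  obtain ⟨c, hc⟩ := hr
  obtain ⟨p, -, hp⟩ := hc 0 1 one_mem_orderFiltration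
  exact ⟨p, hp.trans (one_mul r)⟩

variable {R : Type*} [Ring R] [Algebra ℂ R] {y z : R}

/-- The homomorphism `d ↦ y`, `x ↦ z` given by a pair satisfying the defining relation. -/
noncomputable def lift (h : y * z - z * y = 1) : WeylAlgebraOne →ₐ[ℂ] R :=
  RingQuot.liftAlgHom ℂ ⟨FreeAlgebra.lift ℂ fun g => match g with
    | WeylGen.x => z
    | WeylGen.d => y, by
      rintro _ _ ⟨⟩
      simpa using h⟩

theorem lift_x (h : y * z - z * y = 1) : lift h x = z := by simp [lift, x]

theorem lift_d (h : y * z - z * y = 1) : lift h d = y := by simp [lift, d]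

theorem lift_normallyOrdered (h : y * z - z * y = 1) (p : ℂ[X][X]) :
    lift h (normallyOrdered d x p) = normallyOrdered y z p := by
  induction p using Polynomial.induction_on' with
  | add p p' hp hp' => simp only [map_add, hp, hp']
  | monomial n a =>
    rw [normallyOrdered_monomial, normallyOrdered_monomial, map_mul, map_pow, lift_d,
      ← aeval_algHom_apply, lift_x]

theorem lift_injective [Nontrivial R] (h : y * z - z * y = 1) : Function.Injective (lift h) := by
  intro r s hrs
  obtain ⟨p, rfl⟩ := surjective_normallyOrdered r
  obtain ⟨p', rfl⟩ := surjective_normallyOrdered s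
  rw [lift_normallyOrdered, lift_normallyOrdered] at hrs
  rw [normallyOrdered_injective h hrs]

/-- The anti-automorphism `x ↦ x`, `d ↦ -d`. -/
noncomputable def transpose : WeylAlgebraOne →ₐ[ℂ] WeylAlgebraOneᵐᵒᵖ :=
  lift (op_neg_commutator_eq_one commutator_d_x)

theorem isOreDomain [IsDomain WeylAlgebraOne] : IsOreDomain WeylAlgebraOne := by
  have : Module.IsTorsionFree ℂ[X] WeylAlgebraOne := by
    refine .of_smul_eq_zero fun a r har => ?_
    refine (mul_eq_zero.mp har).imp_left fun ha => ?_
    exact injective_aeval_of_commutator_eq_one commutator_d_x (ha.trans (map_zero _).symm)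
  refine isOreDomain_of_involution (exists_common_left_multiple_of_polynomial_growth
    rightShifters_orderFiltration one_mem_orderFiltration 1 1 rank_orderFiltration_le)
    transpose adjoin_generators ?_
  rintro _ (rfl | rfl)
  · simp [transpose, lift_x]
  · simp [transpose, lift_d]

end WeylAlgebraOne

section Translation

open Multiplicative (ofAdd toAdd)

variable (k : Type*) [Field k]

/-- The translations `f(t) ↦ f(t + n)` of polynomials. -/
noncomputable def polynomialTranslation : Multiplicative ℤ →* (k[X] ≃ₐ[k] k[X]) where
  toFun n := algEquivAevalXAddC ((toAdd n : ℤ) : k)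
  map_one' := AlgEquiv.coe_toAlgHom_injective (Polynomial.algHom_ext (by simp))
  map_mul' m n := AlgEquiv.coe_toAlgHom_injective (Polynomial.algHom_ext (by simp [add_assoc]))

/-- The translations `f(t) ↦ f(t + n)` of rational functions. -/
noncomputable def ratFuncTranslation : Multiplicative ℤ →* (RatFunc k ≃ₐ[k] RatFunc k) :=
  (IsFractionRing.fieldEquivOfAlgEquivHom k (RatFunc k)).comp (polynomialTranslation k)

noncomputable instance : MulSemiringAction (Multiplicative ℤ) (RatFunc k) :=
  MulSemiringAction.compHom (RatFunc k) (ratFuncTranslation k)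

instance : SMulCommClass (Multiplicative ℤ) k (RatFunc k) where
  smul_comm n c f := map_smul (ratFuncTranslation k n) c f

/-- The algebra `k(t)[σ, σ⁻¹]` of difference operators with rational coefficients, where `σ` is
the translation by one. -/
abbrev DifferenceOperator : Type _ := TwistedLaurent (RatFunc k)

variable {k}

/-- The translation `f(t) ↦ f(t + n)`. -/
noncomputable def shift (n : ℤ) : RatFunc k ≃ₐ[k] RatFunc k := ratFuncTranslation k (ofAdd n)

theorem shift_zero (f : RatFunc k) : shift 0 f = f :=
  DFunLike.congr_fun (map_one (ratFuncTranslation k)) f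

theorem shift_X (n : ℤ) : shift n (RatFunc.X : RatFunc k) = RatFunc.X + (n : RatFunc k) := by
  rw [← RatFunc.algebraMap_X]
  refine (IsFractionRing.fieldEquivOfAlgEquiv_algebraMap ..).trans ?_
  simp [polynomialTranslation]

theorem shift_aeval (n : ℤ) (f : RatFunc k) (p : k[X]) :
    shift n (aeval f p) = aeval (shift n f) p :=
  (aeval_algHom_apply (shift n) f p).symm

theorem aeval_ratFuncX (p : k[X]) : aeval (RatFunc.X : RatFunc k) p = algebraMap k[X] _ p := by
  rw [← RatFunc.algebraMap_X, aeval_algebraMap_apply, aeval_X_left_apply]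

theorem linear_ratFunc_ne_zero [CharZero k] {a : ℤ} (b : ℤ) (ha : a ≠ 0) :
    (a : RatFunc k) * RatFunc.X + (b : RatFunc k) ≠ 0 := by
  rw [← RatFunc.algebraMap_X, ← map_intCast (algebraMap k[X] (RatFunc k)),
    ← map_intCast (algebraMap k[X] (RatFunc k)), ← map_mul, ← map_add]
  refine (map_ne_zero_iff _ (RatFunc.algebraMap_injective k)).mpr fun h => ha ?_
  have hcoeff := congrArg (coeff · 1) h
  rw [← C_eq_intCast, ← C_eq_intCast] at hcoeff
  simpa only [coeff_add, coeff_C_mul, coeff_X_one, mul_one, coeff_C_of_ne_zero one_ne_zero,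
    add_zero, coeff_zero, Int.cast_eq_zero] using hcoeff

end Translation

namespace DifferenceOperator

open TwistedLaurent

variable {k : Type*} [Field k]

theorem term_mul (m n : ℤ) (a b : RatFunc k) :
    term m a * term n b = term (m + n) (a * shift m b) :=
  term_mul_term m n a b

/-- The inclusion of the operators of multiplication by rational functions. -/
noncomputable def const : RatFunc k →ₐ[k] DifferenceOperator k where
  toFun := term 0
  map_zero' := term_zero_right 0
  map_one' := rfl
  map_add' := term_add 0
  map_mul' a b := by rw [term_mul, shift_zero, add_zero]
  commutes' c := rfl

theorem const_apply (f : RatFunc k) : const f = term 0 f := rfl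

/-- The difference operator `a σ² + b σ + c + d σ⁻¹ + e σ⁻²`. -/
noncomputable def band (a b c d e : RatFunc k) : DifferenceOperator k :=
  term 2 a + term 1 b + term 0 c + term (-1) d + term (-2) e

theorem band_add (a b c d e a' b' c' d' e' : RatFunc k) :
    band a b c d e + band a' b' c' d' e'
      = band (a + a') (b + b') (c + c') (d + d') (e + e') := by
  simp only [band, term_add]
  abel

theorem const_eq_band (f : RatFunc k) : const f = band 0 0 f 0 0 := by
  simp [band, term_zero_right, const_apply]

theorem band_mul_band (b c d b' c' d' : RatFunc k) :
    band 0 b c d 0 * band 0 b' c' d' 0 =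
      band (b * shift 1 b') (b * shift 1 c' + c * b')
        (b * shift 1 d' + c * c' + d * shift (-1) b')
        (c * d' + d * shift (-1) c') (d * shift (-1) d') := by
  simp only [band, term_zero_right, zero_add, term_add, mul_add, add_mul, term_mul,
    add_zero, shift_zero, Int.reduceAdd, Int.reduceNeg]
  abel

theorem const_mul_band (f a b c d e : RatFunc k) :
    const f * band a b c d e = band (f * a) (f * b) (f * c) (f * d) (f * e) := by
  simp only [band, const_apply, mul_add, term_mul, shift_zero, zero_add]

theorem band_sub (a b c d e a' b' c' d' e' : RatFunc k) :
    band a b c d e - band a' b' c' d' e'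
      = band (a - a') (b - b') (c - c') (d - d') (e - e') := by
  rw [sub_eq_iff_eq_add, band_add]
  simp only [sub_add_cancel]

end DifferenceOperator

namespace KleinianD

open DifferenceOperator

section DifferenceRepresentation

local notation "x" => (RatFunc.X : RatFunc ℂ)

variable (q : ℂ[X])

/-- The coefficient of `σ` in the difference operator representing `v`. -/
noncomputable def coeffUp : RatFunc ℂ := aeval x q / (x * (2 * x + 1))

/-- The coefficient of `σ⁻¹` in the difference operator representing `v`. -/
noncomputable def coeffDown : RatFunc ℂ := aeval (-x) q / (x * (2 * x - 1))

/-- The coefficient of `1` in the difference operator representing `v`. -/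
noncomputable def coeffConst : RatFunc ℂ := 2 * algebraMap ℂ _ (rho q) / (1 - 4 * x ^ 2)

theorem ratFuncX_ne_zero : x ≠ 0 := by
  simpa using linear_ratFunc_ne_zero (k := ℂ) (a := 1) 0 one_ne_zero

theorem two_mul_ratFuncX_add_one_ne_zero : 2 * x + 1 ≠ 0 := by
  simpa using linear_ratFunc_ne_zero (k := ℂ) (a := 2) 1 two_ne_zero

theorem two_mul_ratFuncX_sub_one_ne_zero : 2 * x - 1 ≠ 0 := by
  simpa [sub_eq_add_neg] using linear_ratFunc_ne_zero (k := ℂ) (a := 2) (-1) two_ne_zero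

theorem coeffUp_mul : coeffUp q * (x * (2 * x + 1)) = aeval x q :=
  div_mul_cancel₀ _ (mul_ne_zero ratFuncX_ne_zero two_mul_ratFuncX_add_one_ne_zero)

theorem coeffDown_mul : coeffDown q * (x * (2 * x - 1)) = aeval (-x) q :=
  div_mul_cancel₀ _ (mul_ne_zero ratFuncX_ne_zero two_mul_ratFuncX_sub_one_ne_zero)

theorem coeffConst_mul : coeffConst q * (1 - 4 * x ^ 2) = 2 * algebraMap ℂ _ (rho q) := by
  refine div_mul_cancel₀ _ ?_
  have hne := mul_ne_zero two_mul_ratFuncX_add_one_ne_zero two_mul_ratFuncX_sub_one_ne_zero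
  exact fun h => hne (by linear_combination -h)

theorem shift_one_coeffConst :
    (2 * x + 3) * shift 1 (coeffConst q) = (2 * x - 1) * coeffConst q := by
  have hshift := congrArg (shift 1) (coeffConst_mul q)
  simp only [map_mul, map_sub, map_one, map_pow, map_ofNat, shift_X, Int.cast_one,
    AlgEquiv.commutes] at hshift
  refine mul_left_cancel₀ two_mul_ratFuncX_add_one_ne_zero ?_
  linear_combination coeffConst_mul q - hshift

theorem shift_neg_one_coeffConst :
    (2 * x - 3) * shift (-1) (coeffConst q) = (2 * x + 1) * coeffConst q := by
  have hshift := congrArg (shift (-1)) (coeffConst_mul q)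
  simp only [map_mul, map_sub, map_one, map_pow, map_ofNat, shift_X, Int.cast_neg, Int.cast_one,
    AlgEquiv.commutes] at hshift
  refine mul_left_cancel₀ two_mul_ratFuncX_sub_one_ne_zero ?_
  linear_combination coeffConst_mul q - hshift

theorem shift_one_coeffDown :
    shift 1 (coeffDown q) * ((x + 1) * (2 * x + 1)) = aeval (-x - 1) q := by
  have hshift := congrArg (shift 1) (coeffDown_mul q)
  simp only [map_mul, map_sub, map_one, map_neg, map_ofNat, shift_aeval, shift_X,
    Int.cast_one, neg_add'] at hshift
  linear_combination hshift

theorem shift_neg_one_coeffUp :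
    shift (-1) (coeffUp q) * ((x - 1) * (2 * x - 1)) = aeval (x - 1) q := by
  have hshift := congrArg (shift (-1)) (coeffUp_mul q)
  simp only [map_mul, map_add, map_one, map_ofNat, shift_aeval, shift_X, Int.cast_neg,
    Int.cast_one, ← sub_eq_add_neg] at hshift
  linear_combination hshift

theorem aeval_p_mul (f : RatFunc ℂ) :
    (aeval (f ^ 2) (p0 q) + aeval (f ^ 2) (p1 q) * f) * (1 + 2 * f) ^ 2
      = -4 * aeval f q * aeval (-f - 1) q + algebraMap ℂ _ (rho q) ^ 2 := by
  have hp := congrArg (aeval f) (p_mul q)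
  rw [p_eq, numer] at hp
  simpa only [map_add, map_mul, map_pow, map_neg, map_ofNat, aeval_comp, aeval_X, map_one,
    map_sub, aeval_C] using hp

theorem aeval_p0_add_aeval_p1 : aeval (x ^ 2) (p0 q) + aeval (x ^ 2) (p1 q) * x
    = -4 * x * (x + 1) * (coeffUp q * shift 1 (coeffDown q))
      + ((1 - 2 * x) * coeffConst q / 2) ^ 2 := by
  refine mul_right_cancel₀ (pow_ne_zero 2 two_mul_ratFuncX_add_one_ne_zero) ?_
  linear_combination aeval_p_mul q x + 4 * aeval (-x - 1) q * coeffUp_mul q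
    + 4 * x * (2 * x + 1) * coeffUp q * shift_one_coeffDown q
    - (1 / 4) * (coeffConst q * (1 - 4 * x ^ 2) + 2 * algebraMap ℂ _ (rho q)) * coeffConst_mul q

theorem aeval_p0_sub_aeval_p1 : aeval (x ^ 2) (p0 q) - aeval (x ^ 2) (p1 q) * x
    = -4 * x * (x - 1) * (coeffDown q * shift (-1) (coeffUp q))
      + ((1 + 2 * x) * coeffConst q / 2) ^ 2 := by
  have hp := aeval_p_mul q (-x)
  rw [neg_neg, neg_sq] at hp
  refine mul_right_cancel₀ (pow_ne_zero 2 two_mul_ratFuncX_sub_one_ne_zero) ?_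
  linear_combination hp + 4 * aeval (x - 1) q * coeffDown_mul q
    + 4 * x * (2 * x - 1) * coeffDown q * shift_neg_one_coeffUp q
    - (1 / 4) * (coeffConst q * (1 - 4 * x ^ 2) + 2 * algebraMap ℂ _ (rho q)) * coeffConst_mul q

/-- The difference operator representing `u`. -/
noncomputable def opU : DifferenceOperator ℂ := band 0 0 (x ^ 2) 0 0

/-- The difference operator representing `v`. -/
noncomputable def opV : DifferenceOperator ℂ :=
  band 0 (coeffUp q) (coeffConst q) (coeffDown q) 0

/-- The difference operator representing `w`. -/
noncomputable def opW : DifferenceOperator ℂ :=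
  band 0 (-(x + 1) * coeffUp q) (-coeffConst q / 2) ((x - 1) * coeffDown q) 0

theorem aeval_opU (r : ℂ[X]) : aeval opU r = band 0 0 (aeval (x ^ 2) r) 0 0 := by
  rw [opU, ← const_eq_band, ← const_eq_band, aeval_algHom_apply]

theorem algebraMap_eq_band (c : ℂ) :
    algebraMap ℂ (DifferenceOperator ℂ) c = band 0 0 (algebraMap ℂ _ c) 0 0 := by
  rw [← const_eq_band, AlgHom.commutes]

theorem two_eq_band : (2 : DifferenceOperator ℂ) = band 0 0 2 0 0 := by
  rw [← const_eq_band, map_ofNat]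

theorem opU_commutator_opV : opU * opV q - opV q * opU = 2 * opW q + opV q := by
  simp only [opU, opV, opW, two_eq_band, band_mul_band, band_sub, band_add, map_pow, shift_X,
    map_zero, Int.cast_one, Int.cast_neg]
  congr 1 <;> ring

theorem opU_commutator_opW : opU * opW q - opW q * opU
    = 2 * (opV q * opU) + opW q + algebraMap ℂ _ (rho q) := by
  simp only [opU, opV, opW, two_eq_band, algebraMap_eq_band, band_mul_band, band_sub, band_add,
    map_pow, shift_X, map_zero, mul_zero, zero_mul, add_zero, zero_add, Int.cast_one, Int.cast_neg]
  congr 1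
  · ring
  · ring
  · linear_combination coeffConst_mul q / 2
  · ring
  · ring

theorem opV_commutator_opW :
    opV q * opW q - opW q * opV q = -opV q ^ 2 - aeval opU (p1 q) := by
  rw [aeval_opU, ← zero_sub (opV q ^ 2), sub_sub, eq_sub_iff_add_eq, sq, ← map_zero const,
    const_eq_band, opV, opW]
  simp only [band_mul_band, band_sub, band_add, map_mul, map_div₀, map_neg, map_add, map_sub,
    map_one, map_ofNat, shift_X, Int.cast_one, Int.cast_neg]
  congr 1
  · ring
  · linear_combination (coeffUp q / 2) * shift_one_coeffConst q
  · refine mul_left_cancel₀ (mul_ne_zero two_ne_zero ratFuncX_ne_zero) ?_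
    linear_combination aeval_p0_add_aeval_p1 q - aeval_p0_sub_aeval_p1 q
  · linear_combination (-coeffDown q / 2) * shift_neg_one_coeffConst q
  · ring

theorem opW_sq : opW q ^ 2
    = opV q ^ 2 * opU + opV q * opW q + rho q • opV q + aeval opU (p0 q) := by
  rw [sq, sq, mul_assoc, aeval_opU, Algebra.smul_def, algebraMap_eq_band, opU, opV, opW]
  have : algebraMap ℂ (RatFunc ℂ) (rho q) = coeffConst q * (1 - 4 * x ^ 2) / 2 := by
    linear_combination -coeffConst_mul q / 2
  rw [this]
  simp only [band_mul_band, band_add, map_mul, map_div₀, map_neg, map_add, map_sub, map_pow,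
    map_one, map_ofNat, map_zero, mul_zero, zero_mul, add_zero, zero_add, shift_X, Int.cast_one,
    Int.cast_neg]
  congr 1
  · ring
  · linear_combination (-x * coeffUp q / 2) * shift_one_coeffConst q
  · linear_combination (-aeval_p0_add_aeval_p1 q - aeval_p0_sub_aeval_p1 q) / 2
  · linear_combination (-x * coeffDown q / 2) * shift_neg_one_coeffConst q
  · ring

end DifferenceRepresentation

end KleinianD

section EvenPolynomials

variable {k : Type*} [Field k]

theorem aeval_ratFuncX_sq (a : k[X]) :
    aeval ((RatFunc.X : RatFunc k) ^ 2) a = algebraMap k[X] _ (expand k 2 a) := by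
  rw [← aeval_ratFuncX, expand_aeval]

theorem aeval_ratFuncX_sq_ne_zero {a : k[X]} (ha : a ≠ 0) :
    aeval ((RatFunc.X : RatFunc k) ^ 2) a ≠ 0 := by
  rw [aeval_ratFuncX_sq]
  exact (map_ne_zero_iff _ (RatFunc.algebraMap_injective k)).mpr ((expand_ne_zero two_pos).mpr ha)

theorem eq_zero_of_aeval_ratFuncX_sq {a b : k[X]} (c : k)
    (h : aeval ((RatFunc.X : RatFunc k) ^ 2) a
      = (RatFunc.X + algebraMap k _ c) * aeval (RatFunc.X ^ 2) b) : a = 0 ∧ b = 0 := by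
  have h' : expand k 2 a = (X + C c) * expand k 2 b := by
    apply RatFunc.algebraMap_injective k
    rw [map_mul, map_add, RatFunc.algebraMap_X, RatFunc.algebraMap_C, ← aeval_ratFuncX_sq,
      ← aeval_ratFuncX_sq, h, RatFunc.algebraMap_eq_C]
  have hb : b = 0 := by
    by_contra hb
    have hdegree := congrArg natDegree h'
    rw [natDegree_mul (X_add_C_ne_zero c) ((expand_ne_zero two_pos).mpr hb), natDegree_X_add_C,
      natDegree_expand, natDegree_expand] at hdegree
    omega
  rw [hb, map_zero, mul_zero, expand_eq_zero two_pos] at h'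
  exact ⟨h', hb⟩

end EvenPolynomials

namespace KleinianD

/-- The defining relations of `D(q)`, as conditions on a triple of elements of an algebra. -/
structure Relations {B : Type*} [Ring B] [Algebra ℂ B] (q : ℂ[X]) (a b c : B) : Prop where
  uv : a * b - b * a = 2 * c + b
  uw : a * c - c * a = 2 * (b * a) + c + algebraMap ℂ B (rho q)
  vw : b * c - c * b = -b ^ 2 - aeval a (p1 q)
  ww : c ^ 2 = b ^ 2 * a + b * c + rho q • b + aeval a (p0 q)

end KleinianD

namespace KleinianDAlgebra

open KleinianD (Rel Gen Relations rho p0 p1)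

variable (q : ℂ[X])

/-- The generator `u` of `D(q)`. -/
noncomputable def u : KleinianDAlgebra q := RingQuot.mkAlgHom ℂ (Rel q) KleinianD.u

/-- The generator `v` of `D(q)`. -/
noncomputable def v : KleinianDAlgebra q := RingQuot.mkAlgHom ℂ (Rel q) KleinianD.v

/-- The generator `w` of `D(q)`. -/
noncomputable def w : KleinianDAlgebra q := RingQuot.mkAlgHom ℂ (Rel q) KleinianD.w

theorem relations : Relations q (u q) (v q) (w q) where
  uv := by simpa [u, v, w, two_mul] using RingQuot.mkAlgHom_rel ℂ (Rel.uv (q := q))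
  uw := by simpa [u, v, w, two_mul] using RingQuot.mkAlgHom_rel ℂ (Rel.uw (q := q))
  vw := by simpa [u, v, w, ← aeval_algHom_apply] using RingQuot.mkAlgHom_rel ℂ (Rel.vw (q := q))
  ww := by simpa [u, v, w, ← aeval_algHom_apply] using RingQuot.mkAlgHom_rel ℂ (Rel.ww (q := q))

theorem adjoin_generators : Algebra.adjoin ℂ {u q, v q, w q} = ⊤ := by
  have hgen : RingQuot.mkAlgHom ℂ (Rel q) '' Set.range (FreeAlgebra.ι ℂ) ⊆ {u q, v q, w q} := by
    rintro _ ⟨_, ⟨_ | _ | _, rfl⟩, rfl⟩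
    exacts [Or.inl rfl, Or.inr (Or.inl rfl), Or.inr (Or.inr rfl)]
  refine top_le_iff.mp (le_trans ?_ (Algebra.adjoin_mono hgen))
  rw [← AlgHom.map_adjoin, FreeAlgebra.adjoin_range_ι, Algebra.map_top]
  exact ((AlgHom.range_eq_top _).mpr (RingQuot.mkAlgHom_surjective ℂ (Rel q))).ge

section Lift

variable {q} {B : Type*} [Ring B] [Algebra ℂ B] {a b c : B} (h : Relations q a b c)

/-- The homomorphism `u ↦ a`, `v ↦ b`, `w ↦ c` given by a triple satisfying the relations. -/
noncomputable def lift : KleinianDAlgebra q →ₐ[ℂ] B :=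
  RingQuot.liftAlgHom ℂ ⟨FreeAlgebra.lift ℂ fun g => match g with
    | Gen.u => a
    | Gen.v => b
    | Gen.w => c, by
      rintro _ _ (_ | _ | _ | _)
      · simpa [two_mul] using h.uv
      · simpa [two_mul] using h.uw
      · simpa [← aeval_algHom_apply] using h.vw
      · simpa [← aeval_algHom_apply] using h.ww⟩

theorem lift_u : lift h (u q) = a := by simp [lift, u]

theorem lift_v : lift h (v q) = b := by simp [lift, v]

theorem lift_w : lift h (w q) = c := by simp [lift, w]

end Lift

/-- `D(q)` as a left `ℂ[u]`-module. -/
noncomputable instance : Module ℂ[X] (KleinianDAlgebra q) :=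
  Module.compHom _ (aeval (u q) : ℂ[X] →ₐ[ℂ] KleinianDAlgebra q).toRingHom

theorem smul_def (a : ℂ[X]) (r : KleinianDAlgebra q) : a • r = aeval (u q) a * r := rfl

instance : IsScalarTower ℂ[X] (KleinianDAlgebra q) (KleinianDAlgebra q) where
  smul_assoc a r s := mul_assoc (aeval (u q) a) r s

instance : IsScalarTower ℂ ℂ[X] (KleinianDAlgebra q) where
  smul_assoc c a r := by simp only [smul_def, map_smul, smul_mul_assoc]

/-- The normally ordered monomials `vʲ` with `j ≤ n` and `vʲ w` with `j < n`. -/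
noncomputable def normalMonomials (n : ℕ) : Set (KleinianDAlgebra q) :=
  (fun j => v q ^ j) '' Set.Iic n ∪ (fun j => v q ^ j * w q) '' Set.Iio n

/-- The filtration of `D(q)` by the degree in `v` and `w`. -/
noncomputable def normalFiltration : ℕ →o Submodule ℂ[X] (KleinianDAlgebra q) where
  toFun n := Submodule.span ℂ[X] (normalMonomials q n)
  monotone' _ _ h := Submodule.span_mono (Set.union_subset_union
    (Set.image_mono (Set.Iic_subset_Iic.mpr h)) (Set.image_mono (Set.Iio_subset_Iio h)))

variable {q}

theorem pow_mem_normalFiltration {j n : ℕ} (h : j ≤ n) : v q ^ j ∈ normalFiltration q n :=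
  Submodule.subset_span (Or.inl ⟨j, h, rfl⟩)

theorem pow_mul_mem_normalFiltration {j n : ℕ} (h : j < n) :
    v q ^ j * w q ∈ normalFiltration q n :=
  Submodule.subset_span (Or.inr ⟨j, h, rfl⟩)

theorem normalFiltration_le {n : ℕ} {M : Submodule ℂ[X] (KleinianDAlgebra q)}
    (hv : ∀ j ≤ n, v q ^ j ∈ M) (hw : ∀ j < n, v q ^ j * w q ∈ M) : normalFiltration q n ≤ M := by
  refine Submodule.span_le.mpr (Set.union_subset ?_ ?_)
  · rintro _ ⟨j, hj, rfl⟩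
    exact hv j hj
  · rintro _ ⟨j, hj, rfl⟩
    exact hw j hj

theorem normalFiltration_succ_le {n : ℕ} {M : Submodule ℂ[X] (KleinianDAlgebra q)}
    (h : normalFiltration q n ≤ M) (hv : v q ^ (n + 1) ∈ M) (hw : v q ^ n * w q ∈ M) :
    normalFiltration q (n + 1) ≤ M := by
  refine normalFiltration_le (fun j hj => ?_) (fun j hj => ?_)
  · rcases hj.lt_or_eq with hj | rfl
    exacts [h (pow_mem_normalFiltration (Nat.le_of_lt_succ hj)), hv]
  · rcases (Nat.le_of_lt_succ hj).lt_or_eq with hj | rfl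
    exacts [h (pow_mul_mem_normalFiltration hj), hw]

theorem exists_eq_smul_one_of_mem_normalFiltration_zero {r : KleinianDAlgebra q}
    (hr : r ∈ normalFiltration q 0) : ∃ a : ℂ[X], r = a • 1 := by
  have hle : normalFiltration q 0 ≤ ℂ[X] ∙ (1 : KleinianDAlgebra q) :=
    normalFiltration_le (fun j hj => by
      rw [Nat.le_zero.mp hj, pow_zero]
      exact Submodule.mem_span_singleton_self 1) (by simp)
  obtain ⟨a, rfl⟩ := Submodule.mem_span_singleton.mp (hle hr)
  exact ⟨a, rfl⟩

theorem exists_eq_add_of_mem_normalFiltration_succ {n : ℕ} {r : KleinianDAlgebra q}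
    (hr : r ∈ normalFiltration q (n + 1)) : ∃ s ∈ normalFiltration q n, ∃ a b : ℂ[X],
      r = s + (a • v q ^ (n + 1) + b • (v q ^ n * w q)) := by
  have hle := normalFiltration_succ_le
    (M := normalFiltration q n ⊔ Submodule.span ℂ[X] {v q ^ (n + 1), v q ^ n * w q})
    le_sup_left (Submodule.mem_sup_right (Submodule.subset_span (Or.inl rfl)))
    (Submodule.mem_sup_right (Submodule.subset_span (Or.inr rfl)))
  obtain ⟨s, hs, t, ht, rfl⟩ := Submodule.mem_sup.mp (hle hr)
  obtain ⟨a, b, rfl⟩ := Submodule.mem_span_pair.mp ht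
  exact ⟨s, hs, a, b, rfl⟩

theorem one_mem_normalFiltration : 1 ∈ normalFiltration q 0 :=
  pow_zero (v q) ▸ pow_mem_normalFiltration le_rfl

theorem v_mul_u : v q * u q = u q * v q - 2 • w q - v q := by
  linear_combination (norm := noncomm_ring) -(relations q).uv

theorem w_mul_u :
    w q * u q = u q * w q - 2 • (v q * u q) - w q - algebraMap ℂ _ (rho q) := by
  linear_combination (norm := noncomm_ring) -(relations q).uw

theorem w_mul_v : w q * v q = v q * w q + v q ^ 2 + aeval (u q) (p1 q) := by
  linear_combination (norm := noncomm_ring) -(relations q).vw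

theorem pow_succ_mul_u (n : ℕ) : v q ^ (n + 1) * u q
    = v q ^ n * u q * v q - 2 • (v q ^ n * w q) - v q ^ (n + 1) := by
  rw [pow_succ, mul_assoc, v_mul_u]
  simp only [mul_sub, mul_smul_comm, mul_assoc]

theorem pow_mul_w_mul_u (n : ℕ) : v q ^ n * w q * u q
    = v q ^ n * u q * w q - 2 • (v q ^ (n + 1) * u q) - v q ^ n * w q - rho q • v q ^ n := by
  rw [mul_assoc, w_mul_u, Algebra.algebraMap_eq_smul_one]
  simp only [mul_sub, mul_smul_comm, mul_one, pow_succ, mul_assoc]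

theorem pow_mul_w_mul_v (n : ℕ) : v q ^ n * w q * v q
    = v q ^ (n + 1) * w q + v q ^ (n + 2) + v q ^ n * aeval (u q) (p1 q) := by
  rw [mul_assoc, w_mul_v, pow_add _ n 2]
  simp only [mul_add, pow_succ, mul_assoc]

theorem pow_mul_w_mul_w (n : ℕ) : v q ^ n * w q * w q
    = v q ^ (n + 2) * u q + v q ^ (n + 1) * w q + rho q • v q ^ (n + 1)
      + v q ^ n * aeval (u q) (p0 q) := by
  rw [mul_assoc, ← sq, (relations q).ww, pow_add _ n 2]
  simp only [mul_add, mul_smul_comm, pow_succ _ n, mul_assoc]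

theorem mul_aeval_mem {M : Submodule ℂ[X] (KleinianDAlgebra q)} (hM : ∀ r ∈ M, r * u q ∈ M)
    (a : ℂ[X]) {r : KleinianDAlgebra q} (hr : r ∈ M) : r * aeval (u q) a ∈ M := by
  induction a using Polynomial.induction_on with
  | C c =>
    rw [aeval_C, ← Algebra.commutes, ← Algebra.smul_def]
    exact M.smul_of_tower_mem c hr
  | add a b ha hb => rw [map_add, mul_add]; exact add_mem ha hb
  | monomial n c h =>
    rw [pow_succ, ← mul_assoc, map_mul, aeval_X, ← mul_assoc]
    exact hM _ h

theorem mul_v_mem_of_mul_u_mem {n : ℕ}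
    (hu : ∀ r ∈ normalFiltration q n, r * u q ∈ normalFiltration q n) :
    ∀ r ∈ normalFiltration q n, r * v q ∈ normalFiltration q (n + 1) := by
  refine normalFiltration_le (M := (normalFiltration q (n + 1)).comap
    (LinearMap.mulRight ℂ[X] (v q))) (fun j hj => ?_) (fun j hj => ?_)
  · rw [Submodule.mem_comap, LinearMap.mulRight_apply, ← pow_succ]
    exact pow_mem_normalFiltration (Nat.succ_le_succ hj)
  · rw [Submodule.mem_comap, LinearMap.mulRight_apply, pow_mul_w_mul_v]
    exact add_mem (add_mem (pow_mul_mem_normalFiltration (by omega))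
      (pow_mem_normalFiltration (by omega))) ((normalFiltration q).mono n.le_succ
        (mul_aeval_mem hu _ (pow_mem_normalFiltration hj.le)))

theorem pow_succ_mul_u_mem_of_mul_u_mem {n : ℕ}
    (hu : ∀ r ∈ normalFiltration q n, r * u q ∈ normalFiltration q n) :
    v q ^ (n + 1) * u q ∈ normalFiltration q (n + 1) := by
  rw [pow_succ_mul_u]
  refine sub_mem (sub_mem ?_ (nsmul_mem (pow_mul_mem_normalFiltration n.lt_succ_self) 2))
    (pow_mem_normalFiltration le_rfl)
  exact mul_v_mem_of_mul_u_mem hu _ (hu _ (pow_mem_normalFiltration le_rfl))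

theorem mul_w_mem_of_mul_u_mem {n : ℕ}
    (hu : ∀ r ∈ normalFiltration q n, r * u q ∈ normalFiltration q n) :
    ∀ r ∈ normalFiltration q n, r * w q ∈ normalFiltration q (n + 1) := by
  refine normalFiltration_le (M := (normalFiltration q (n + 1)).comap
    (LinearMap.mulRight ℂ[X] (w q))) (fun j hj => ?_) (fun j hj => ?_)
  · exact pow_mul_mem_normalFiltration (Nat.lt_succ_of_le hj)
  rw [Submodule.mem_comap, LinearMap.mulRight_apply, pow_mul_w_mul_w]
  refine add_mem (add_mem (add_mem ?_ (pow_mul_mem_normalFiltration (by omega)))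
    (Submodule.smul_of_tower_mem _ _ (pow_mem_normalFiltration (by omega))))
    ((normalFiltration q).mono n.le_succ (mul_aeval_mem hu _ (pow_mem_normalFiltration hj.le)))
  rcases (Nat.succ_le_of_lt hj).lt_or_eq with hj | rfl
  · exact (normalFiltration q).mono n.le_succ (hu _ (pow_mem_normalFiltration hj))
  · exact pow_succ_mul_u_mem_of_mul_u_mem hu

theorem mul_u_mem (n : ℕ) : ∀ r ∈ normalFiltration q n, r * u q ∈ normalFiltration q n := by
  induction n with
  | zero =>
    refine normalFiltration_le (M := (normalFiltration q 0).comap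
      (LinearMap.mulRight ℂ[X] (u q))) (fun j hj => ?_) (by simp)
    have hsmul : (X : ℂ[X]) • (1 : KleinianDAlgebra q) = v q ^ j * u q := by
      rw [Nat.le_zero.mp hj, smul_def, aeval_X, pow_zero, one_mul, mul_one]
    rw [Submodule.mem_comap, LinearMap.mulRight_apply, ← hsmul]
    exact Submodule.smul_mem _ X one_mem_normalFiltration
  | succ n hu =>
    have hvu := pow_succ_mul_u_mem_of_mul_u_mem hu
    refine normalFiltration_succ_le (M := (normalFiltration q (n + 1)).comap
      (LinearMap.mulRight ℂ[X] (u q))) (fun r hr => (normalFiltration q).mono n.le_succ (hu r hr))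
      hvu ?_
    rw [Submodule.mem_comap, LinearMap.mulRight_apply, pow_mul_w_mul_u]
    exact sub_mem (sub_mem (sub_mem
      (mul_w_mem_of_mul_u_mem hu _ (hu _ (pow_mem_normalFiltration le_rfl))) (nsmul_mem hvu 2))
      (pow_mul_mem_normalFiltration n.lt_succ_self))
      (Submodule.smul_of_tower_mem _ _ (pow_mem_normalFiltration n.le_succ))

theorem rightShifters_normalFiltration : rightShifters (normalFiltration q) = ⊤ := by
  refine rightShifters_eq_top_of_adjoin_eq_top (adjoin_generators q) ?_
  rintro _ (rfl | rfl | rfl)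
  exacts [⟨0, mul_u_mem⟩, ⟨1, fun n => mul_v_mem_of_mul_u_mem (mul_u_mem n)⟩,
    ⟨1, fun n => mul_w_mem_of_mul_u_mem (mul_u_mem n)⟩]

theorem exists_mem_normalFiltration (r : KleinianDAlgebra q) : ∃ n, r ∈ normalFiltration q n := by
  have hr : r ∈ rightShifters (normalFiltration q) :=
    rightShifters_normalFiltration ▸ Subring.mem_top r
  obtain ⟨c, hc⟩ := hr
  exact ⟨0 + c, one_mul r ▸ hc 0 1 one_mem_normalFiltration⟩

theorem rank_normalFiltration_le (n : ℕ) :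
    Module.rank ℂ[X] (normalFiltration q n) ≤ (2 * (n + 1) ^ 1 : ℕ) := by
  refine (rank_span_le _).trans ((Cardinal.mk_union_le _ _).trans ?_)
  refine (add_le_add Cardinal.mk_image_le Cardinal.mk_image_le).trans ?_
  rw [Cardinal.mk_fintype, Cardinal.mk_fintype, Fintype.card_Iic, Fintype.card_Iio]
  norm_cast
  rw [Nat.card_Iic, Nat.card_Iio, pow_one]
  omega

end KleinianDAlgebra

namespace DifferenceOperator

open TwistedLaurent
open Multiplicative (ofAdd)

variable {k : Type*} [Field k]

theorem const_mul (f : RatFunc k) (r : DifferenceOperator k) : const f * r = f • r := by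
  rw [const_apply, ← mul_one f, ← smul_term]
  exact (smul_mul_assoc f 1 r).trans (by rw [one_mul, mul_one])

theorem band_mem_degreeLE_one (b c d : RatFunc k) :
    band 0 b c d 0 ∈ TwistedLaurent.degreeLE (RatFunc k) 1 := by
  rw [band, term_zero_right, term_zero_right, zero_add, add_zero]
  exact add_mem (add_mem (term_mem_degreeLE le_rfl b) (term_mem_degreeLE (by decide) c))
    (term_mem_degreeLE (by decide) d)

theorem coeff_one_band (b c d : RatFunc k) : (band 0 b c d 0).coeff (ofAdd 1) = b := by
  simp [band, coeff_term]

end DifferenceOperator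

namespace KleinianD

open DifferenceOperator TwistedLaurent
open Multiplicative (ofAdd)

variable {q : ℂ[X]}

variable (q) in
theorem relations_op : Relations q opU (opV q) (opW q) :=
  ⟨opU_commutator_opV q, opU_commutator_opW q, opV_commutator_opW q, opW_sq q⟩

theorem coeffUp_ne_zero (hq : q ≠ 0) : coeffUp q ≠ 0 := by
  refine div_ne_zero ?_ (mul_ne_zero ratFuncX_ne_zero two_mul_ratFuncX_add_one_ne_zero)
  rw [aeval_ratFuncX]
  exact (map_ne_zero_iff _ (RatFunc.algebraMap_injective ℂ)).mpr hq

theorem opV_pow_mem_degreeLE (n : ℕ) : opV q ^ n ∈ TwistedLaurent.degreeLE (RatFunc ℂ) n := by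
  induction n with
  | zero => exact term_mem_degreeLE le_rfl 1
  | succ n ih =>
    rw [pow_succ, Nat.cast_succ]
    exact mul_mem_degreeLE ih (band_mem_degreeLE_one _ _ _)

variable (q) in
/-- The leading coefficient of `opV q ^ n`. -/
noncomputable def leadingCoeffPow (n : ℕ) : RatFunc ℂ := (opV q ^ n).coeff (ofAdd n)

theorem coeff_opV_pow_mul_band (n : ℕ) (b c d : RatFunc ℂ) :
    (opV q ^ n * band 0 b c d 0).coeff (ofAdd (n + 1 : ℤ)) = leadingCoeffPow q n * shift n b := by
  rw [coeff_add_mul_of_mem_degreeLE (opV_pow_mem_degreeLE n) (band_mem_degreeLE_one _ _ _),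
    coeff_one_band]
  rfl

theorem leadingCoeffPow_succ (n : ℕ) :
    leadingCoeffPow q (n + 1) = leadingCoeffPow q n * shift n (coeffUp q) := by
  rw [leadingCoeffPow, pow_succ, Nat.cast_succ]
  exact coeff_opV_pow_mul_band ..

theorem leadingCoeffPow_ne_zero (hq : q ≠ 0) (n : ℕ) : leadingCoeffPow q n ≠ 0 := by
  induction n with
  | zero =>
    have h : leadingCoeffPow q 0 = 1 := (coeff_term 0 0 1).trans (if_pos rfl)
    exact h ▸ one_ne_zero
  | succ n ih =>
    rw [leadingCoeffPow_succ]
    exact mul_ne_zero ih ((_root_.map_ne_zero _).mpr (coeffUp_ne_zero hq))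

theorem coeff_opV_pow_mul_opW (n : ℕ) : (opV q ^ n * opW q).coeff (ofAdd (n + 1 : ℤ))
    = -(RatFunc.X + algebraMap ℂ _ (n + 1)) * leadingCoeffPow q (n + 1) := by
  rw [opW, coeff_opV_pow_mul_band, leadingCoeffPow_succ]
  simp only [map_mul, map_neg, map_add, shift_X, map_one, map_natCast, Int.cast_natCast]
  ring

end KleinianD

section Opposite

open MulOpposite (op)

theorem aeval_op {k R : Type*} [CommSemiring k] [Semiring R] [Algebra k R] (r : R) (a : k[X]) :
    aeval (op r) a = op (aeval r a) := by
  induction a using Polynomial.induction_on' with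
  | add a b ha hb => simp only [map_add, ha, hb, MulOpposite.op_add]
  | monomial n c =>
    rw [aeval_monomial, aeval_monomial, Algebra.commutes c (r ^ n), MulOpposite.op_mul,
      MulOpposite.op_pow, MulOpposite.algebraMap_apply]

end Opposite

namespace KleinianD

open MulOpposite (op)

theorem Relations.opposite {q : ℂ[X]} {B : Type*} [Ring B] [Algebra ℂ B] {a b c : B}
    (h : Relations q a b c) : Relations q (op a) (op b) (op (-c - b)) where
  uv := MulOpposite.unop_injective <| show b * a - a * b = (-c - b) * 2 + b by
    linear_combination (norm := noncomm_ring) -h.uv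
  uw := MulOpposite.unop_injective <|
    show (-c - b) * a - a * (-c - b) = (a * b) * 2 + (-c - b) + algebraMap ℂ B (rho q) by
      linear_combination (norm := noncomm_ring) h.uw - h.uv
  vw := by
    rw [aeval_op]
    refine MulOpposite.unop_injective ?_
    change (-c - b) * b - b * (-c - b) = -b ^ 2 - aeval a (p1 q)
    linear_combination (norm := noncomm_ring) h.vw
  ww := by
    rw [aeval_op]
    refine MulOpposite.unop_injective ?_
    change (-c - b) ^ 2 = a * b ^ 2 + (-c - b) * b + rho q • b + aeval a (p0 q)
    linear_combination (norm := noncomm_ring) h.ww - h.uv * b - b * h.uv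

end KleinianD

namespace KleinianDAlgebra

open KleinianD DifferenceOperator TwistedLaurent
open Multiplicative (ofAdd)

/-- The representation of `D(q)` by difference operators. -/
noncomputable def rep (q : ℂ[X]) : KleinianDAlgebra q →ₐ[ℂ] DifferenceOperator ℂ :=
  lift (relations_op q)

variable {q : ℂ[X]}

theorem rep_u : rep q (u q) = opU := lift_u _

theorem rep_v : rep q (v q) = opV q := lift_v _

theorem rep_w : rep q (w q) = opW q := lift_w _

theorem rep_smul (a : ℂ[X]) (r : KleinianDAlgebra q) :
    rep q (a • r) = aeval (RatFunc.X ^ 2 : RatFunc ℂ) a • rep q r := by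
  rw [smul_def, map_mul, ← aeval_algHom_apply, rep_u, aeval_opU, ← const_eq_band, const_mul]

theorem rep_mem_degreeLE {n : ℕ} {r : KleinianDAlgebra q} (hr : r ∈ normalFiltration q n) :
    rep q r ∈ TwistedLaurent.degreeLE (RatFunc ℂ) n := by
  induction hr using Submodule.span_induction with
  | zero => exact map_zero (rep q) ▸ zero_mem _
  | add r s _ _ hr hs => exact map_add (rep q) r s ▸ add_mem hr hs
  | smul a r _ hr => exact rep_smul a r ▸ Submodule.smul_mem _ _ hr
  | mem r hr =>
    rcases hr with ⟨j, hj, rfl⟩ | ⟨j, hj, rfl⟩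
    · rw [map_pow, rep_v]
      exact degreeLE_mono (Int.ofNat_le.mpr hj) (opV_pow_mem_degreeLE j)
    · rw [map_mul, map_pow, rep_v, rep_w]
      exact degreeLE_mono (Int.ofNat_le.mpr hj)
        (mul_mem_degreeLE (opV_pow_mem_degreeLE j) (band_mem_degreeLE_one _ _ _))

theorem coeff_rep_smul_add_smul (n : ℕ) (a b : ℂ[X]) :
    (rep q (a • v q ^ (n + 1) + b • (v q ^ n * w q))).coeff (ofAdd (n + 1 : ℤ)) =
      (aeval (RatFunc.X ^ 2) a - (RatFunc.X + algebraMap ℂ _ (n + 1)) * aeval (RatFunc.X ^ 2) b) *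
        leadingCoeffPow q (n + 1) := by
  have hv : (opV q ^ (n + 1)).coeff (ofAdd (n + 1 : ℤ)) = leadingCoeffPow q (n + 1) := by
    rw [leadingCoeffPow, Nat.cast_succ]
  simp only [map_add, rep_smul, map_mul, map_pow, rep_v, rep_w, SkewMonoidAlgebra.coeff_add,
    SkewMonoidAlgebra.coeff_smul, Finsupp.add_apply, Finsupp.smul_apply, hv,
    coeff_opV_pow_mul_opW, smul_eq_mul]
  ring

theorem eq_zero_of_rep_eq_zero_of_mem (hq : q ≠ 0) {n : ℕ} {r : KleinianDAlgebra q}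
    (hr : r ∈ normalFiltration q n) (h : rep q r = 0) : r = 0 := by
  induction n generalizing r with
  | zero =>
    obtain ⟨a, rfl⟩ := exists_eq_smul_one_of_mem_normalFiltration_zero hr
    rw [rep_smul, map_one, smul_eq_zero, or_iff_left one_ne_zero] at h
    rw [not_imp_not.mp aeval_ratFuncX_sq_ne_zero h, zero_smul]
  | succ n ih =>
    obtain ⟨s, hs, a, b, rfl⟩ := exists_eq_add_of_mem_normalFiltration_succ hr
    have hcoeff := congrArg (fun f => f.coeff (ofAdd (n + 1 : ℤ))) h
    simp only [map_add (rep q) s, SkewMonoidAlgebra.coeff_add, Finsupp.add_apply,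
      rep_mem_degreeLE hs _ (lt_add_one (n : ℤ)), zero_add] at hcoeff
    rw [coeff_rep_smul_add_smul] at hcoeff
    obtain ⟨rfl, rfl⟩ := eq_zero_of_aeval_ratFuncX_sq _ (sub_eq_zero.mp
      ((mul_eq_zero.mp hcoeff).resolve_right (leadingCoeffPow_ne_zero hq _)))
    rw [zero_smul, zero_smul, add_zero, add_zero] at h ⊢
    exact ih hs h

theorem rep_injective (hq : q ≠ 0) : Function.Injective (rep q) := by
  refine (injective_iff_map_eq_zero _).mpr fun r h => ?_
  obtain ⟨n, hr⟩ := exists_mem_normalFiltration r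
  exact eq_zero_of_rep_eq_zero_of_mem hq hr h

theorem isTorsionFree (hq : q ≠ 0) : Module.IsTorsionFree ℂ[X] (KleinianDAlgebra q) := by
  refine .of_smul_eq_zero fun a r har => ?_
  have hrep := congrArg (rep q) har
  rw [rep_smul, map_zero, smul_eq_zero] at hrep
  exact hrep.imp (not_imp_not.mp aeval_ratFuncX_sq_ne_zero)
    ((map_eq_zero_iff _ (rep_injective hq)).mp)

/-- The anti-automorphism `u ↦ u`, `v ↦ v`, `w ↦ -w - v`. -/
noncomputable def transpose (q : ℂ[X]) : KleinianDAlgebra q →ₐ[ℂ] (KleinianDAlgebra q)ᵐᵒᵖ :=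
  lift (relations q).opposite

theorem isOreDomain (hq : q ≠ 0) : IsOreDomain (KleinianDAlgebra q) := by
  have := (rep_injective hq).isDomain (rep q).toRingHom
  have := isTorsionFree hq
  refine isOreDomain_of_involution (exists_common_left_multiple_of_polynomial_growth
    rightShifters_normalFiltration one_mem_normalFiltration 2 1 rank_normalFiltration_le)
    (transpose q) (adjoin_generators q) ?_
  rintro _ (rfl | rfl | rfl)
  · simp [transpose, lift_u]
  · simp [transpose, lift_v]
  · simp [transpose, lift_v, lift_w]

end KleinianDAlgebra

section EvenOddParts

variable {R : Type*} [CommRing R]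

theorem exists_eq_comp_sq_add_comp_sq_mul_X (g : R[X]) :
    ∃ g₀ g₁ : R[X], g = g₀.comp (X ^ 2) + g₁.comp (X ^ 2) * X := by
  induction g using Polynomial.induction_on with
  | C a => exact ⟨C a, 0, by rw [C_comp, zero_comp, zero_mul, add_zero]⟩
  | add f g hf hg =>
    obtain ⟨f₀, f₁, rfl⟩ := hf
    obtain ⟨g₀, g₁, rfl⟩ := hg
    exact ⟨f₀ + g₀, f₁ + g₁, by rw [add_comp, add_comp]; ring⟩
  | monomial n a ih =>
    obtain ⟨f₀, f₁, hf⟩ := ih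
    exact ⟨X * f₁, f₀, by rw [pow_succ, ← mul_assoc, hf, mul_comp, X_comp]; ring⟩

theorem sq_sub_X_mul_sq_ne_zero [IsDomain R] {g₀ g₁ : R[X]}
    (hg : g₀.comp (X ^ 2) + g₁.comp (X ^ 2) * X ≠ 0) : g₀ ^ 2 - X * g₁ ^ 2 ≠ 0 := by
  intro hnorm
  have hprod : (g₀.comp (X ^ 2) + g₁.comp (X ^ 2) * X)
      * (g₀.comp (X ^ 2) + g₁.comp (X ^ 2) * X).comp (-X) = 0 := by
    have hcomp := congrArg (fun f => f.comp (X ^ 2)) hnorm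
    simp only [sub_comp, mul_comp, pow_comp, X_comp, zero_comp] at hcomp
    simp only [add_comp, mul_comp, comp_assoc, pow_comp, X_comp, neg_sq]
    linear_combination hcomp
  refine (mul_ne_zero hg fun hneg => hg ?_) hprod
  rw [← comp_neg_X_comp_neg_X (g₀.comp (X ^ 2) + g₁.comp (X ^ 2) * X), hneg, zero_comp]

end EvenOddParts

namespace DifferenceOperator

variable (k : Type*) [Field k]

/-- The skew field of fractions of the algebra of difference operators. -/
abbrev FractionField : Type _ :=
  OreLocalization (DifferenceOperator k)⁰ (DifferenceOperator k)

variable {k}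

/-- The inclusion of the difference operators into their skew field of fractions. -/
noncomputable def toFractionField : DifferenceOperator k →ₐ[k] FractionField k where
  __ := OreLocalization.numeratorRingHom
  commutes' _ := rfl

theorem toFractionField_injective : Function.Injective (toFractionField (k := k)) :=
  OreLocalization.numeratorHom_inj fun _ h => (mem_nonZeroDivisors_iff.mp h).1

theorem toFractionField_ne_zero {r : DifferenceOperator k} (hr : r ≠ 0) :
    toFractionField r ≠ 0 :=
  (map_ne_zero_iff _ toFractionField_injective).mpr hr

end DifferenceOperator

theorem mul_add_mem_iff {K : Type*} [DivisionRing K] {B : Subfield K} {a b y : K} (ha : a ∈ B)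
    (ha0 : a ≠ 0) (hb : b ∈ B) : a * y + b ∈ B ↔ y ∈ B := by
  rw [add_mem_cancel_right hb]
  exact ⟨fun h => inv_mul_cancel_left₀ ha0 y ▸ mul_mem (inv_mem ha) h, mul_mem ha⟩

theorem mul_inv_sub_inv_mul_eq_one {K : Type*} [DivisionRing K] {y z : K} (hy : y ≠ 0)
    (h : y * z - z * y = y ^ 2) : z * y⁻¹ - y⁻¹ * z = 1 := by
  calc z * y⁻¹ - y⁻¹ * z = y⁻¹ * (y * z - z * y) * y⁻¹ := by
        rw [mul_sub, sub_mul, inv_mul_cancel_left₀ hy, ← mul_assoc, mul_inv_cancel_right₀ hy]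
    _ = 1 := by rw [h, sq, inv_mul_cancel_left₀ hy, mul_inv_cancel₀ hy]

namespace KleinianD

open DifferenceOperator

section WeylPair

local notation "x" => (RatFunc.X : RatFunc ℂ)

/-- The difference operator `x⁻¹ (σ - σ⁻¹)`. -/
noncomputable def opY : DifferenceOperator ℂ := band 0 x⁻¹ 0 (-x⁻¹) 0

/-- The difference operator `σ + σ⁻¹`. -/
noncomputable def opZ : DifferenceOperator ℂ := band 0 1 0 1 0

theorem ratFuncX_add_one_ne_zero : x + 1 ≠ 0 := by
  simpa using linear_ratFunc_ne_zero (k := ℂ) (a := 1) 1 one_ne_zero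

theorem ratFuncX_sub_one_ne_zero : x - 1 ≠ 0 := by
  simpa [sub_eq_add_neg] using linear_ratFunc_ne_zero (k := ℂ) (a := 1) (-1) one_ne_zero

theorem opY_ne_zero : opY ≠ 0 := fun h => by
  have hcoeff := coeff_one_band x⁻¹ 0 (-x⁻¹)
  rw [← opY, h] at hcoeff
  exact inv_ne_zero ratFuncX_ne_zero hcoeff.symm

theorem opY_commutator_opZ : opY * opZ - opZ * opY = opY ^ 2 := by
  have hx := ratFuncX_ne_zero
  have hx₁ := ratFuncX_add_one_ne_zero
  have hx₂ := ratFuncX_sub_one_ne_zero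
  simp only [sq, opY, opZ, band_mul_band, band_sub, map_inv₀, map_neg, map_one, map_zero, shift_X,
    Int.cast_one, Int.cast_neg, ← sub_eq_add_neg]
  congr 1 <;> field_simp <;> ring

theorem opU_mul_opY_sq : opU * opY ^ 2 = opZ ^ 2 - 4 - opZ * opY := by
  have hx := ratFuncX_ne_zero
  have hx₁ := ratFuncX_add_one_ne_zero
  have hx₂ := ratFuncX_sub_one_ne_zero
  rw [← map_ofNat const 4, const_eq_band, sq, sq, opY, opZ, opU, ← const_eq_band]
  simp only [band_mul_band, const_mul_band, band_sub, map_inv₀, map_neg, map_one, map_zero,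
    shift_X, Int.cast_one, Int.cast_neg, ← sub_eq_add_neg]
  congr 1 <;> field_simp <;> ring

variable {q g₀ g₁ : ℂ[X]}

theorem aeval_eq_even_add_odd (hg : q * (2 * X - 1) = g₀.comp (X ^ 2) + g₁.comp (X ^ 2) * X)
    (f : RatFunc ℂ) : aeval f q * (2 * f - 1) = aeval (f ^ 2) g₀ + aeval (f ^ 2) g₁ * f := by
  simpa only [map_mul, map_sub, map_add, map_pow, map_one, map_ofNat, aeval_comp, aeval_X]
    using congrArg (aeval f) hg

theorem opV_eq_opY_opZ (hg : q * (2 * X - 1) = g₀.comp (X ^ 2) + g₁.comp (X ^ 2) * X) :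
    aeval opU (4 * X - 1 : ℂ[X]) * opV q + aeval opU (C (2 * rho q))
      = aeval opU g₀ * opY + aeval opU g₁ * opZ := by
  have hx := ratFuncX_ne_zero
  have hpos := aeval_eq_even_add_odd hg x
  have hneg := aeval_eq_even_add_odd hg (-x)
  rw [neg_sq] at hneg
  simp only [aeval_opU, opV, opY, opZ, ← const_eq_band, const_mul_band]
  rw [const_eq_band, band_add, band_add]
  simp only [map_sub, map_mul, map_ofNat, map_one, aeval_X, aeval_C]
  congr 1
  · ring
  · field_simp
    linear_combination (2 * x - 1) * coeffUp_mul q + hpos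
  · linear_combination -coeffConst_mul q
  · field_simp
    linear_combination (2 * x + 1) * coeffDown_mul q - hneg
  · ring

theorem opW_add_opV_eq_opY_opZ
    (hg : q * (2 * X - 1) = g₀.comp (X ^ 2) + g₁.comp (X ^ 2) * X) :
    aeval opU (4 * X - 1 : ℂ[X]) * (opW q + opV q) + aeval opU (C (rho q))
      = aeval opU (-X * g₁) * opY + aeval opU (-g₀) * opZ := by
  have hpos := aeval_eq_even_add_odd hg x
  have hneg := aeval_eq_even_add_odd hg (-x)
  rw [neg_sq] at hneg
  simp only [aeval_opU, opV, opW, opY, opZ, band_add, ← const_eq_band,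
    const_mul_band]
  rw [const_eq_band, band_add]
  simp only [map_sub, map_mul, map_neg, map_ofNat, map_one, aeval_X, aeval_C]
  congr 1
  · ring
  · field_simp
    linear_combination -(2 * x - 1) * coeffUp_mul q - hpos
  · linear_combination -coeffConst_mul q / 2
  · field_simp
    linear_combination (2 * x + 1) * coeffDown_mul q - hneg
  · ring

end WeylPair

section Fractions

theorem commutator_opZ_opY_inv :
    toFractionField opZ * (toFractionField opY)⁻¹
      - (toFractionField opY)⁻¹ * toFractionField opZ = 1 := by
  refine mul_inv_sub_inv_mul_eq_one (toFractionField_ne_zero opY_ne_zero) ?_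
  rw [← map_mul, ← map_mul, ← map_sub, opY_commutator_opZ, map_pow]

theorem opU_mem_of_opY_opZ_mem {B : Subfield (FractionField ℂ)} (hY : toFractionField opY ∈ B)
    (hZ : toFractionField opZ ∈ B) : toFractionField opU ∈ B := by
  have hprod := congrArg toFractionField opU_mul_opY_sq
  rw [map_mul, map_pow,
    ← eq_mul_inv_iff_mul_eq₀ (pow_ne_zero 2 (toFractionField_ne_zero opY_ne_zero)), map_sub,
    map_sub, map_pow, map_mul, map_ofNat] at hprod
  exact hprod ▸ mul_mem (sub_mem (sub_mem (pow_mem hZ 2) (ofNat_mem B 4)) (mul_mem hZ hY))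
    (inv_mem (pow_mem hY 2))

theorem aeval_opU_ne_zero {r : ℂ[X]} (hr : r ≠ 0) : aeval opU r ≠ 0 := by
  rw [aeval_opU, ← const_eq_band]
  exact (map_ne_zero_iff _ (const (k := ℂ)).toRingHom.injective).mpr (aeval_ratFuncX_sq_ne_zero hr)

variable {q : ℂ[X]} {B : Subfield (FractionField ℂ)}

theorem opV_opW_mem_iff_opY_opZ_mem (hq : q ≠ 0)
    (hU : ∀ a : ℂ[X], toFractionField (aeval opU a) ∈ B) :
    toFractionField (opV q) ∈ B ∧ toFractionField (opW q) ∈ B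
      ↔ toFractionField opY ∈ B ∧ toFractionField opZ ∈ B := by
  have hlin (a : ℕ) [a.AtLeastTwo] : (OfNat.ofNat a * X - 1 : ℂ[X]) ≠ 0 := fun h => by
    simpa using congrArg (eval 0) h
  obtain ⟨g₀, g₁, hg⟩ := exists_eq_comp_sq_add_comp_sq_mul_X (q * (2 * X - 1))
  have hdet : g₀ * -g₀ - g₁ * (-X * g₁) ≠ 0 := fun h =>
    sq_sub_X_mul_sq_ne_zero (hg ▸ mul_ne_zero hq (hlin 2)) (by linear_combination -h)
  have hscale := toFractionField_ne_zero (aeval_opU_ne_zero (hlin 4))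
  have hV := congrArg (toFractionField · ∈ B) (opV_eq_opY_opZ hg)
  have hVW := congrArg (toFractionField · ∈ B) (opW_add_opV_eq_opY_opZ hg)
  simp only [map_add toFractionField, map_mul toFractionField,
    mul_add_mem_iff (hU _) hscale (hU _)] at hV hVW
  constructor
  · rintro ⟨hVB, hWB⟩
    exact mem_subfield_of_det_ne_zero (toFractionField.comp (aeval opU)).toRingHom hU
      (toFractionField_ne_zero (aeval_opU_ne_zero hdet)) (hV ▸ hVB) (hVW ▸ add_mem hWB hVB)
  · rintro ⟨hY, hZ⟩
    have hVB := hV ▸ add_mem (mul_mem (hU g₀) hY) (mul_mem (hU g₁) hZ)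
    have hVWB := hVW ▸ add_mem (mul_mem (hU (-X * g₁)) hY) (mul_mem (hU (-g₀)) hZ)
    exact ⟨hVB, (add_mem_cancel_right hVB).mp hVWB⟩

theorem divisionClosure_opU_opV_opW (hq : q ≠ 0) :
    divisionClosure ℂ {toFractionField opU, toFractionField (opV q), toFractionField (opW q)}
      = divisionClosure ℂ {(toFractionField opY)⁻¹, toFractionField opZ} := by
  have aeval_mem {s : Set (FractionField ℂ)} (hU : toFractionField opU ∈ divisionClosure ℂ s)
      (a : ℂ[X]) : toFractionField (aeval opU a) ∈ divisionClosure ℂ s :=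
    aeval_algHom_apply toFractionField opU a ▸ aeval_mem_divisionClosure hU a
  set D := divisionClosure ℂ
    {toFractionField opU, toFractionField (opV q), toFractionField (opW q)}
  set D' := divisionClosure ℂ {(toFractionField opY)⁻¹, toFractionField opZ}
  apply le_antisymm <;> apply divisionClosure_le_divisionClosure
  · have hY : toFractionField opY ∈ D' := inv_mem_iff.mp (subset_divisionClosure (Or.inl rfl))
    have hZ : toFractionField opZ ∈ D' := subset_divisionClosure (Or.inr rfl)
    have hU := opU_mem_of_opY_opZ_mem hY hZ
    obtain ⟨hV, hW⟩ := (opV_opW_mem_iff_opY_opZ_mem hq (aeval_mem hU)).mpr ⟨hY, hZ⟩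
    rintro _ (rfl | rfl | rfl)
    exacts [hU, hV, hW]
  · have hU : toFractionField opU ∈ D := subset_divisionClosure (Or.inl rfl)
    have hV : toFractionField (opV q) ∈ D := subset_divisionClosure (Or.inr (Or.inl rfl))
    have hW : toFractionField (opW q) ∈ D := subset_divisionClosure (Or.inr (Or.inr rfl))
    obtain ⟨hY, hZ⟩ := (opV_opW_mem_iff_opY_opZ_mem hq (aeval_mem hU)).mp ⟨hV, hW⟩
    rintro _ (rfl | rfl)
    exacts [inv_mem hY, hZ]

end Fractions

end KleinianD

instance WeylAlgebraOne.instIsDomain : IsDomain WeylAlgebraOne :=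
  (lift_injective KleinianD.commutator_opZ_opY_inv).isDomain
    (lift KleinianD.commutator_opZ_opY_inv).toRingHom

open DifferenceOperator KleinianD KleinianDAlgebra in
theorem mainTheorem6_general (q : ℂ[X]) (hq : q ≠ 0) :
    ∃ (_ : IsOreDomain (KleinianDAlgebra q)) (_ : IsOreDomain WeylAlgebraOne),
      Nonempty (SkewFrac (KleinianDAlgebra q) ≃ₐ[ℂ] SkewFrac WeylAlgebraOne) := by
  have hD := KleinianDAlgebra.isOreDomain hq
  have hW := WeylAlgebraOne.isOreDomain
  refine ⟨hD, hW, nonempty_skewFrac_algEquiv_of_divisionClosure_eq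
    (f := toFractionField.comp (rep q)) (toFractionField_injective.comp (rep_injective hq))
    (WeylAlgebraOne.lift_injective commutator_opZ_opY_inv) (KleinianDAlgebra.adjoin_generators q)
    WeylAlgebraOne.adjoin_generators ?_⟩
  simp only [Set.image_insert_eq, Set.image_singleton, WeylAlgebraOne.lift_x,
    WeylAlgebraOne.lift_d, AlgHom.comp_apply, rep_u, rep_v, rep_w,
    divisionClosure_opU_opV_opW hq]

theorem mainTheorem6 (q : ℂ[X]) (hq : 4 ≤ q.natDegree) :
    ∃ (_ : IsOreDomain (KleinianDAlgebra q)) (_ : IsOreDomain WeylAlgebraOne),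
      Nonempty (SkewFrac (KleinianDAlgebra q) ≃ₐ[ℂ] SkewFrac WeylAlgebraOne) :=
  mainTheorem6_general q (ne_zero_of_natDegree_gt hq)
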